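/- **Model.** There are $m\ge 1$ servers of speed $\mu>0$ (bits/s), chunks of $c>0$ bits, and integers $\alpha_k\ge k$ ($k\in\mathbb Z_+$). Requests arrive as a Poisson process of rate $\lambda m>0$ with inter-arrival times $\tau_0,\tau_1,\dots$; the $n$-th request is for a file of $\kappa_n$ chunks, where the $\kappa_n$ are i.i.d. with probability mass function $\pi=(\pi_k)_{k\in\mathbb Z_+}$ and independent of the arrival process. Given $\kappa_n=k$, the placement vector $a_n\in\mathbb Z_+^m$ is, independently of the past, equal to $\lfloor\alpha_k/m\rfloor+1$ on a uniformly random set of $\alpha_k-m\lfloor\alpha_k/m\rfloor$ servers and to $\lfloor\alpha_k/m\rfloor$ elsewhere. The system starts empty; $W_n$ is the workload vector (in bits) seen by the $n$-th arrival and $s_n\in\mathbb Z_+^m$, with $|s_n|=\kappa_n$ and $s_n\le a_n$, is its routing vector: $$W_0=0,\qquad W_{n+1}=(W_n+c\,s_n-\mu\tau_n\mathbf 1)^+ .$$ Given the past, $\kappa_n=k$, $a_n=a$ and $W_n=w$, the vector $s_n$ is chosen, independently of $\tau_n$, by one of these policies, where $q=\lfloor k/m\rfloor$, $k'=k-mq$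 and $A=\{i: a^i>q\}$. * BR (Balanced Random): $s_n^i=q+1$ on a uniformly random $k'$-element subset of $A$, and $s_n^i=q$ elsewhere. * BS (Batch Sampling): the same, but the $k'$ servers of $A$ are picked one after the other, each time a server of least workload $w^i$ among those of $A$ not yet picked, ties being broken uniformly at random. * WF (Water-filling): the $k$ blocks are requested one after the other, each time from a server with least current value of $w^i+c\cdot(\text{number of blocks already requested from } i)$ among the servers $i$ from which fewer than $a^i$ blocks have been requested, ties being broken uniformly at random. For $\pi_k>0$, let $D_n^k$ be a random variable whose law is the conditional law given $\kappa_n=k$ of the delay $\max_{i:\,s_n^i>0}(W_n^i+c\,s_n^i)$ (a maximum over the empty set is $0$). A random vector $X$ is *associated* if $E[f(X)g(X)]\ge E[f(X)]\,E[g(X)]$ for all coordinatewise increasing $f,g$ for which the three expectations exist; $X\le^{icx}Y$ means $E[g(X)]\le E[g(Y)]$ for all increasing convex $g:\mathbb R\to\mathbb R$ for which both expectations exist. $\Theta(m)$ is the class of all $\pi$ for which the routing vector $s_n$ under BR is associated for each $n$. A *Cavity Queue* is an M/GI/1 FCFS queue that starts empty, with Poisson arrivals of rate $\lambda m$, service rate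 $\mu$, and i.i.d. service requirements with probability mass function $$\tilde\pi(0)=1-\sum_{k=1}^m\tfrac km\pi_k-\sum_{k=m+1}^\infty\pi_k,\qquad \tilde\pi(lc)=\sum_{k=(l-1)m+1}^{lm}\Big(\tfrac km-l+1\Big)\pi_k+\sum_{k=lm+1}^{(l+1)m-1}\Big(1-\tfrac km+l\Big)\pi_k\quad(l\ge1).$$ **Theorem.** Suppose $\pi\in\Theta(m)$. 1. Under BR, the workload vector $W_n$ is associated for each $n\ge0$. 2. Let $\{\tilde W^i_n\}_{n\ge 0}$, $i=1,\dots,m$, be the workloads seen by the successive arrivals in $m$ mutually independent Cavity Queues, and let ${}^k\!s$ be independent of them and distributed as the BR routing vector of a request for $k$ chunks. Then under each of WF, BS and BR, for all $n\ge 0$ and all $k\ge 0$ with $\pi_k>0$, $$D_n^k\ \le^{icx}\ \max_{i:\ {}^k\!s^i>0}\ \tilde W_n^i+c\;{}^k\!s^i ,$$ where a maximum over the empty set is $0$. -/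

import Mathlib

open MeasureTheory ProbabilityTheory
open scoped ENNReal

namespace DataCluster

/-! ### Association and the increasing convex order -/

/-- The random vector `X` is associated under `P`: `E[f(X)] E[g(X)] ≤ E[f(X) g(X)]` for all
(coordinatewise) increasing Borel functions `f`, `g` for which the three expectations exist. -/
def Associated {Ω ι : Type*} [MeasurableSpace Ω] (P : Measure Ω) (X : Ω → ι → ℝ) : Prop :=
  ∀ f g : (ι → ℝ) → ℝ, Monotone f → Monotone g → Measurable f → Measurable g →
    Integrable (fun ω => f (X ω)) P → Integrable (fun ω => g (X ω)) P →
    Integrable (fun ω => f (X ω) * g (X ω)) P →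
    (∫ ω, f (X ω) ∂P) * (∫ ω, g (X ω) ∂P) ≤ ∫ ω, f (X ω) * g (X ω) ∂P

/-- The expectation of `Z` exists in `[-∞, ∞]`: the positive or the negative part is integrable. -/
def ExpectationExists {Ω : Type*} [MeasurableSpace Ω] (P : Measure Ω) (Z : Ω → ℝ) : Prop :=
  (∫⁻ ω, ENNReal.ofReal (Z ω) ∂P) ≠ ∞ ∨ (∫⁻ ω, ENNReal.ofReal (-Z ω) ∂P) ≠ ∞

/-- The expectation of `Z` as an extended real, `E[Z⁺] - E[Z⁻]`. -/
noncomputable def extExpectation {Ω : Type*} [MeasurableSpace Ω] (P : Measure Ω) (Z : Ω → ℝ) :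
    EReal :=
  ((∫⁻ ω, ENNReal.ofReal (Z ω) ∂P : ℝ≥0∞) : EReal) -
    ((∫⁻ ω, ENNReal.ofReal (-Z ω) ∂P : ℝ≥0∞) : EReal)

/-- `X ≤^{icx} Y`, where `X` lives on `(Ω, P)` and `Y` on `(Ω', Q)`: `E[g(X)] ≤ E[g(Y)]` (with
values in `[-∞, ∞]`) for all increasing convex `g : ℝ → ℝ` for which both expectations exist. -/
def IcxLE {Ω Ω' : Type*} [MeasurableSpace Ω] [MeasurableSpace Ω']
    (P : Measure Ω) (X : Ω → ℝ) (Q : Measure Ω') (Y : Ω' → ℝ) : Prop :=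
  ∀ g : ℝ → ℝ, Monotone g → ConvexOn ℝ Set.univ g →
    ExpectationExists P (fun ω => g (X ω)) → ExpectationExists Q (fun ω => g (Y ω)) →
    extExpectation P (fun ω => g (X ω)) ≤ extExpectation Q (fun ω => g (Y ω))

/-! ### Placement of code blocks and routing policies -/

/-- Uniform choice of an element of `S` (and `d` in the irrelevant case that `S` is empty). -/
noncomputable def uniformOr {β : Type*} (S : Finset β) (d : β) : PMF β :=
  open Classical in if h : S.Nonempty then PMF.uniformOfFinset S h else PMF.pure d

/-- The vector with entry `q + 1` on `T` and entry `q` elsewhere. -/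
def levelVector {m : ℕ} (q : ℕ) (T : Finset (Fin m)) : Fin m → ℕ :=
  fun i => if i ∈ T then q + 1 else q

/-- Law of the placement vector of a file with `b` code blocks on `m` servers: `⌊b/m⌋` blocks on
each server, and one more block on each server of a uniformly random set of `b - m⌊b/m⌋` servers. -/
noncomputable def placementLaw (m b : ℕ) : PMF (Fin m → ℕ) :=
  (uniformOr (Finset.powersetCard (b % m) (Finset.univ : Finset (Fin m))) ∅).map
    (levelVector (b / m))

/-- The servers that hold a block beyond the `⌊k/m⌋` blocks requested from every server. -/
def extraServers {m : ℕ} (k : ℕ) (a : Fin m → ℕ) : Finset (Fin m) :=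
  Finset.univ.filter fun i => k / m < a i

/-- The set of minimizers of `w` over `A`. -/
noncomputable def argminOn {m : ℕ} (A : Finset (Fin m)) (w : Fin m → ℝ) : Finset (Fin m) :=
  A.filter fun i => ∀ j ∈ A, w i ≤ w j

/-- Balanced random: `⌊k/m⌋` blocks from each server, and one more block from each server of a
uniformly random set of `k - m⌊k/m⌋` servers that have an additional block. -/
noncomputable def balancedRandom {m : ℕ} (k : ℕ) (a : Fin m → ℕ) : PMF (Fin m → ℕ) :=
  (uniformOr (Finset.powersetCard (k % m) (extraServers k a)) ∅).map (levelVector (k / m))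

/-- Successive selection of `l` distinct servers of `A` with least workload `w`; ties are broken
uniformly at random. -/
noncomputable def leastLoaded {m : ℕ} (w : Fin m → ℝ) (A : Finset (Fin m)) :
    ℕ → PMF (Finset (Fin m))
  | 0 => PMF.pure ∅
  | l + 1 => (leastLoaded w A l).bind fun T =>
      uniformOr ((argminOn (A \ T) w).image fun i => insert i T) T

/-- Batch sampling: `⌊k/m⌋` blocks from each server, and one more block from each of the
`k - m⌊k/m⌋` least loaded servers among those that have an additional block. -/
noncomputable def batchSampling {m : ℕ} (w : Fin m → ℝ) (k : ℕ) (a : Fin m → ℕ) :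
    PMF (Fin m → ℕ) :=
  (leastLoaded w (extraServers k a) (k % m)).map (levelVector (k / m))

/-- Water-filling: the blocks are requested one at a time, each from a server with least current
workload (`w` plus `c` times the number of blocks already requested there) among the servers that
still have an unrequested block; ties are broken uniformly at random. -/
noncomputable def waterFilling {m : ℕ} (c : ℝ) (w : Fin m → ℝ) (a : Fin m → ℕ) :
    ℕ → PMF (Fin m → ℕ)
  | 0 => PMF.pure 0
  | l + 1 => (waterFilling c w a l).bind fun s =>
      uniformOr ((argminOn (Finset.univ.filter fun i => s i < a i)
        (fun i => w i + c * (s i : ℝ))).image fun i => s + Pi.single i 1) s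

/-- The three delivery policies. -/
inductive Policy
  | WF
  | BS
  | BR

/-- Law of the routing vector for workload `w`, file size `k` (in chunks) and placement `a`. -/
noncomputable def Policy.routing {m : ℕ} (c : ℝ) :
    Policy → (Fin m → ℝ) → ℕ → (Fin m → ℕ) → PMF (Fin m → ℕ)
  | .WF, w, k, a => waterFilling c w a k
  | .BS, w, k, a => batchSampling w k a
  | .BR, _, k, a => balancedRandom k a

/-! ### The system -/

/-- Parameters: `m` servers of speed `μ` bits/s, chunks of `c` bits, requests arriving as a Poisson
process of rate `lam * m`, file sizes (in chunks) with probability mass function `π`, and `α k` code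
blocks for each file of `k` chunks. -/
structure Params where
  m : ℕ
  c : ℝ
  μ : ℝ
  lam : ℝ
  π : PMF ℕ
  α : ℕ → ℕ
  m_pos : 0 < m
  c_pos : 0 < c
  μ_pos : 0 < μ
  lam_pos : 0 < lam
  le_α : ∀ k, k ≤ α k

/-- Delay of a request with routing vector `s` that sees the workload `w`: the maximum of
`w i + c * s i` over the servers with `s i > 0` (and `0` if no block is requested). -/
noncomputable def delay {m : ℕ} (c : ℝ) (w : Fin m → ℝ) (s : Fin m → ℕ) : ℝ :=
  if h : (Finset.univ.filter fun i => 0 < s i).Nonempty then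
    (Finset.univ.filter fun i => 0 < s i).sup' h fun i => w i + c * (s i : ℝ)
  else 0

/-- The σ-algebra of the history before the `n`-th arrival, generated by the file sizes, placement
vectors, routing vectors and inter-arrival times with index `j < n`. -/
@[reducible] def history {Ω : Type*} {m : ℕ} (κ : ℕ → Ω → ℕ) (a s : ℕ → Ω → Fin m → ℕ) (τ : ℕ → Ω → ℝ)
    (n : ℕ) : MeasurableSpace Ω :=
  ⨆ j, ⨆ (_ : j < n),
    MeasurableSpace.comap (fun ω => (κ j ω, a j ω, s j ω, τ j ω)) inferInstance

/-- `κ, a, s, τ, W` are the file sizes, placement vectors, routing vectors, inter-arrival times and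
workloads seen by the successive arrivals, in a system with parameters `p` that starts empty and is
operated under the policy `pol`. The field `step` gives the conditional law of
`(κ n, a n, s n, τ n)` given the history: `κ n` has law `π`, `a n` is a uniform placement of
`α (κ n)` blocks, `s n` is drawn by the policy from `W n`, `κ n`, `a n`, and `τ n` is exponential of
rate `lam * m` and independent of the history and of `κ n`, `a n`, `s n`. -/
structure IsSystem {Ω : Type*} [MeasurableSpace Ω] (P : Measure Ω) (p : Params) (pol : Policy)
    (κ : ℕ → Ω → ℕ) (a s : ℕ → Ω → Fin p.m → ℕ) (τ : ℕ → Ω → ℝ)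
    (W : ℕ → Ω → Fin p.m → ℝ) : Prop where
  measurable_κ : ∀ n, Measurable (κ n)
  measurable_a : ∀ n, Measurable (a n)
  measurable_s : ∀ n, Measurable (s n)
  measurable_τ : ∀ n, Measurable (τ n)
  step : ∀ (n : ℕ) (A : Set Ω), MeasurableSet[history κ a s τ n] A →
    ∀ (k : ℕ) (x r : Fin p.m → ℕ) (B : Set ℝ), MeasurableSet B →
      P (A ∩ {ω | κ n ω = k ∧ a n ω = x ∧ s n ω = r ∧ τ n ω ∈ B}) =
        (∫⁻ ω in A, p.π k * placementLaw p.m (p.α k) x * pol.routing p.c (W n ω) k x r ∂P) *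
          expMeasure (p.lam * p.m) B
  W_zero : ∀ ω, W 0 ω = 0
  W_succ : ∀ n ω i,
    W (n + 1) ω i = max (W n ω i + p.c * (s n ω i : ℝ) - p.μ * τ n ω) 0

/-- Law of a typical balanced random routing vector of a request for `k` chunks. -/
noncomputable def typicalBR (m : ℕ) (α : ℕ → ℕ) (k : ℕ) : PMF (Fin m → ℕ) :=
  (placementLaw m (α k)).bind fun a => balancedRandom k a

/-- The class `Θ(m)` of probability mass functions for which the balanced random routing vector is
associated. (Its law does not depend on the choice of code sizes `α k ≥ k`.) -/
def Theta (m : ℕ) (α : ℕ → ℕ) : Set (PMF ℕ) :=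
  {π | Associated (π.bind (typicalBR m α)).toMeasure (fun s i => (s i : ℝ))}

/-! ### The Cavity Queue -/

/-- Probability that a job of the Cavity Queue requires `l * c` bits of service. -/
noncomputable def cavityMass (m : ℕ) (π : PMF ℕ) : ℕ → ℝ
  | 0 => 1 - ∑ k ∈ Finset.Icc 1 m, (k : ℝ) / m * (π k).toReal - ∑' k : ℕ, (π (m + 1 + k)).toReal
  | j + 1 =>
      (∑ k ∈ Finset.Ioc (j * m) ((j + 1) * m), ((k : ℝ) / m - j) * (π k).toReal) +
        ∑ k ∈ Finset.Ioo ((j + 1) * m) ((j + 2) * m), (1 - (k : ℝ) / m + (j + 1)) * (π k).toReal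

/-- `W` is the workload seen by the successive arrivals in a Cavity Queue: an M/GI/1 FCFS queue that
starts empty, has Poisson arrivals of rate `lam * m`, service rate `μ`, and i.i.d. service
requirements `X n` with `Pr (X n = l * c) = cavityMass l`. -/
def IsCavityWorkload {Ω : Type*} [MeasurableSpace Ω] (Q : Measure Ω) (p : Params)
    (W : ℕ → Ω → ℝ) : Prop :=
  ∃ X τ : ℕ → Ω → ℝ,
    (∀ n, Measurable (X n)) ∧ (∀ n, Measurable (τ n)) ∧
    iIndepFun (Sum.elim X τ) Q ∧
    (∀ n l, Q {ω | X n ω = p.c * (l : ℕ)} = ENNReal.ofReal (cavityMass p.m p.π l)) ∧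
    (∀ n, Q.map (τ n) = expMeasure (p.lam * p.m)) ∧
    (∀ ω, W 0 ω = 0) ∧
    ∀ n ω, W (n + 1) ω = max (W n ω + X n ω - p.μ * τ n ω) 0

end DataCluster

/-!
Under balanced random routing the routing vectors are independent of the workload, so the workload
seen by the next arrival is an increasing function of three independent objects: the present
workload, the routing vector and minus the inter-arrival time. The routing vector is associated
since `π ∈ Θ(m)`, a single real variable always is, and association passes to independent pairs
(`PosAssoc.prod`) and increasing images (`PosAssoc.map`). By induction the workload is associated
(`posAssoc_brWorkloadLaw`).

For the delay, call an increasing symmetric convex function of the workload vector with values in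
`[0, ∞]` a test function (`SymConvex`; infinite values spare every integrability condition).
Given the workload, batch sampling and water-filling place the blocks greedily, so that any
balanced random choice arises from theirs by moving blocks to higher levels (`routing_greedy`). This
increases the value of every test function at the levels (`Greedy.symConvex_le`, as the
reverse move averages the vector with a transposition of it) as well as the delay
(`Greedy.delay_le`). A balanced random step maps test functions to test functions, because the
routing vector is exchangeable and independent of the workload (`SymConvex.brStep`). By induction
the mean of a test function of the workload is largest under balanced random
(`IsSystem.lintegral_W_le`). As the mean cost of a typical balanced random request is such a
function of the workload (`symConvex_delay`), the delay under any policy is dominated by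
that of a balanced random request in the balanced random system
(`IsSystem.lintegral_delay_cond_le`).

Finally, each coordinate of the balanced random workload evolves as the workload of a Cavity Queue:
by exchangeability the number of blocks requested from a server has the mass function `cavityMass`
(`toReal_marginal_eq_cavityMass`, `IsCavityWorkload.map_eq`). By association the joint distribution
function of the workload dominates the product of the marginal ones, so maxima over sets of servers
are stochastically smaller than for independent Cavity Queues (`PosAssoc.lintegral_delay_le`).
-/

namespace DataCluster

/-! ### Association of measures -/

/-- A measure on a preordered space is associated if increasing functions are positively
correlated under it. Only bounded functions are tested, so that no integrability has to be assumed
and the notion passes to products; `PosAssoc.associated` recovers `Associated` by truncation. -/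
def PosAssoc {E : Type*} [Preorder E] [MeasurableSpace E] (ν : Measure E) : Prop :=
  ∀ f g : E → ℝ, Monotone f → Monotone g → Measurable f → Measurable g →
    (∃ C, ∀ x, |f x| ≤ C) → (∃ C, ∀ x, |g x| ≤ C) →
    (∫ x, f x ∂ν) * (∫ x, g x ∂ν) ≤ ∫ x, f x * g x ∂ν

theorem integrable_of_abs_le {E : Type*} [MeasurableSpace E] {ν : Measure E} [IsFiniteMeasure ν]
    {f : E → ℝ} (hf : Measurable f) {C : ℝ} (hC : ∀ x, |f x| ≤ C) : Integrable f ν :=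
  Integrable.of_bound hf.aestronglyMeasurable C (ae_of_all _ hC)

theorem abs_mul_le_of_abs_le {a b C D : ℝ} (ha : |a| ≤ C) (hb : |b| ≤ D) : |a * b| ≤ C * D := by
  rw [abs_mul]
  exact mul_le_mul ha hb (abs_nonneg _) ((abs_nonneg _).trans ha)

theorem abs_integral_le_of_abs_le {E : Type*} [MeasurableSpace E] {ν : Measure E}
    [IsProbabilityMeasure ν] {f : E → ℝ} {C : ℝ} (hC : ∀ x, |f x| ≤ C) :
    |∫ x, f x ∂ν| ≤ C := by
  simpa using norm_integral_le_of_norm_le_const (μ := ν) (f := f) (C := C) (ae_of_all _ hC)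

theorem integral_map_mul {E F : Type*} [MeasurableSpace E] [MeasurableSpace F] {ν : Measure E}
    {φ : E → F} (hφ : Measurable φ) {f g : F → ℝ} (hf : Measurable f) (hg : Measurable g) :
    ∫ y, f y * g y ∂ν.map φ = ∫ x, f (φ x) * g (φ x) ∂ν :=
  integral_map hφ.aemeasurable (hf.mul hg).aestronglyMeasurable

theorem PosAssoc.map {E F : Type*} [Preorder E] [MeasurableSpace E] [Preorder F]
    [MeasurableSpace F] {ν : Measure E} (h : PosAssoc ν) {φ : E → F} (hφ : Monotone φ)
    (hm : Measurable φ) : PosAssoc (ν.map φ) := by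
  rintro f g hf hg hfm hgm ⟨C, hC⟩ ⟨D, hD⟩
  rw [integral_map hm.aemeasurable hfm.aestronglyMeasurable,
    integral_map hm.aemeasurable hgm.aestronglyMeasurable,
    integral_map_mul hm hfm hgm]
  exact h _ _ (hf.comp hφ) (hg.comp hφ) (hfm.comp hm) (hgm.comp hm) ⟨C, fun _ => hC _⟩
    ⟨D, fun _ => hD _⟩

/-- Independent associated vectors are jointly associated: apply association first in the second
coordinate, and then to the partial means, which increase with the first one. -/
theorem PosAssoc.prod {E F : Type*} [Preorder E] [MeasurableSpace E] [Preorder F]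
    [MeasurableSpace F] {ν : Measure E} {ξ : Measure F} [IsProbabilityMeasure ν]
    [IsProbabilityMeasure ξ] (hν : PosAssoc ν) (hξ : PosAssoc ξ) : PosAssoc (ν.prod ξ) := by
  rintro f g hf hg hfm hgm ⟨C, hC⟩ ⟨D, hD⟩
  have hfi : Integrable f (ν.prod ξ) := integrable_of_abs_le hfm hC
  have hgi : Integrable g (ν.prod ξ) := integrable_of_abs_le hgm hD
  have hfgm : Measurable fun z => f z * g z := hfm.mul hgm
  have hfgi : Integrable (fun z => f z * g z) (ν.prod ξ) :=
    integrable_of_abs_le hfgm fun z => abs_mul_le_of_abs_le (hC z) (hD z)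
  rw [integral_prod _ hfi, integral_prod _ hgi, integral_prod _ hfgi]
  have mono : ∀ {u : E × F → ℝ}, Monotone u → Measurable u → (∃ B, ∀ z, |u z| ≤ B) →
      Monotone fun x => ∫ y, u (x, y) ∂ξ := by
    rintro u hu hum ⟨B, hB⟩ x x' hx
    exact integral_mono
      (integrable_of_abs_le (hum.comp measurable_prodMk_left) fun y => hB (x, y))
      (integrable_of_abs_le (hum.comp measurable_prodMk_left) fun y => hB (x', y))
      fun y => hu ⟨hx, le_rfl⟩
  have meas : ∀ {u : E × F → ℝ}, Measurable u → Measurable fun x => ∫ y, u (x, y) ∂ξ :=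
    fun hu => hu.stronglyMeasurable.integral_prod_right'.measurable
  refine (hν _ _ (mono hf hfm ⟨C, hC⟩) (mono hg hgm ⟨D, hD⟩) (meas hfm) (meas hgm)
    ⟨C, fun x => abs_integral_le_of_abs_le fun y => hC (x, y)⟩
    ⟨D, fun x => abs_integral_le_of_abs_le fun y => hD (x, y)⟩).trans ?_
  refine integral_mono ?_ ?_ fun x => ?_
  · exact integrable_of_abs_le ((meas hfm).mul (meas hgm)) fun x => abs_mul_le_of_abs_le
      (abs_integral_le_of_abs_le fun y => hC (x, y)) (abs_integral_le_of_abs_le fun y => hD (x, y))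
  · exact integrable_of_abs_le (meas hfgm) fun x =>
      abs_integral_le_of_abs_le fun y => abs_mul_le_of_abs_le (hC (x, y)) (hD (x, y))
  · exact hξ _ _ (fun _ _ h => hf ⟨le_rfl, h⟩) (fun _ _ h => hg ⟨le_rfl, h⟩)
      (hfm.comp measurable_prodMk_left) (hgm.comp measurable_prodMk_left)
      ⟨C, fun y => hC (x, y)⟩ ⟨D, fun y => hD (x, y)⟩

/-- Chebyshev's inequality: a single real random variable is associated. -/
theorem posAssoc_of_linearOrder {E : Type*} [LinearOrder E] [MeasurableSpace E] (ν : Measure E)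
    [IsProbabilityMeasure ν] : PosAssoc ν := by
  rintro f g hf hg hfm hgm ⟨C, hC⟩ ⟨D, hD⟩
  have hfi : Integrable f ν := integrable_of_abs_le hfm hC
  have hgi : Integrable g ν := integrable_of_abs_le hgm hD
  have hfgi : Integrable (fun z => f z * g z) ν :=
    integrable_of_abs_le (hfm.mul hgm) fun z => abs_mul_le_of_abs_le (hC z) (hD z)
  -- integrate `(f x - f y) * (g x - g y) ≥ 0` over two independent copies
  have key : ∀ x y, f x * g y + f y * g x ≤ f x * g x + f y * g y := by
    intro x y
    rcases le_total x y with h | h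
    · nlinarith [mul_nonneg (sub_nonneg.2 (hf h)) (sub_nonneg.2 (hg h))]
    · nlinarith [mul_nonneg (sub_nonneg.2 (hf h)) (sub_nonneg.2 (hg h))]
  have key2 : ∀ x, f x * (∫ y, g y ∂ν) + (∫ y, f y ∂ν) * g x ≤
      f x * g x + ∫ y, f y * g y ∂ν := by
    intro x
    have h := integral_mono (μ := ν) ((hgi.const_mul (f x)).add (hfi.mul_const (g x)))
      ((integrable_const (f x * g x)).add hfgi) (fun y => key x y)
    simp only [Pi.add_apply] at h
    rw [integral_add (hgi.const_mul _) (hfi.mul_const _),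
      integral_add (integrable_const _) hfgi, integral_const_mul, integral_mul_const] at h
    simpa using h
  have h := integral_mono (μ := ν) ((hfi.mul_const (∫ y, g y ∂ν)).add (hgi.const_mul (∫ y, f y ∂ν)))
      (hfgi.add (integrable_const (∫ y, f y * g y ∂ν))) key2
  simp only [Pi.add_apply] at h
  rw [integral_add (hfi.mul_const _) (hgi.const_mul _),
      integral_add hfgi (integrable_const _), integral_const_mul, integral_mul_const] at h
  simp at h
  linarith

theorem posAssoc_dirac {E : Type*} [Preorder E] [MeasurableSpace E] (x : E) :
    PosAssoc (Measure.dirac x) := by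
  rintro f g hf hg hfm hgm - -
  rw [integral_dirac' _ _ hfm.stronglyMeasurable, integral_dirac' _ _ hgm.stronglyMeasurable,
    integral_dirac' (fun x => f x * g x) _ (hfm.mul hgm).stronglyMeasurable]

theorem Associated.posAssoc {Ω ι : Type*} [MeasurableSpace Ω] {P : Measure Ω}
    [IsFiniteMeasure P] {X : Ω → ι → ℝ} (h : Associated P X) (hX : Measurable X) :
    PosAssoc (P.map X) := by
  rintro f g hf hg hfm hgm ⟨C, hC⟩ ⟨D, hD⟩
  rw [integral_map hX.aemeasurable hfm.aestronglyMeasurable,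
    integral_map hX.aemeasurable hgm.aestronglyMeasurable,
    integral_map_mul hX hfm hgm]
  exact h f g hf hg hfm hgm (integrable_of_abs_le (hfm.comp hX) fun _ => hC _)
    (integrable_of_abs_le (hgm.comp hX) fun _ => hD _)
    (integrable_of_abs_le ((hfm.comp hX).mul (hgm.comp hX))
      fun _ => abs_mul_le_of_abs_le (hC _) (hD _))

/-- Truncation of a real number to `[-N, N]`. -/
def clamp (N : ℕ) (x : ℝ) : ℝ := max (-N) (min N x)

theorem monotone_clamp (N : ℕ) : Monotone (clamp N) := fun _ _ h =>
  max_le_max le_rfl (min_le_min le_rfl h)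

theorem measurable_clamp (N : ℕ) : Measurable (clamp N) := (monotone_clamp N).measurable

theorem abs_clamp_le (N : ℕ) (x : ℝ) : |clamp N x| ≤ N := by
  have : (0 : ℝ) ≤ N := N.cast_nonneg
  rw [abs_le]
  exact ⟨le_max_left _ _, max_le (by linarith) (min_le_left _ _)⟩

theorem abs_clamp_le_abs (N : ℕ) (x : ℝ) : |clamp N x| ≤ |x| := by
  have : (0 : ℝ) ≤ N := N.cast_nonneg
  rw [abs_le]
  constructor
  · exact (le_min (by linarith [abs_nonneg x]) (neg_abs_le x)).trans (le_max_right _ _)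
  · exact max_le (by linarith [abs_nonneg x]) ((min_le_right _ _).trans (le_abs_self x))

theorem tendsto_clamp (x : ℝ) :
    Filter.Tendsto (fun N => clamp N x) Filter.atTop (nhds x) := by
  refine tendsto_const_nhds.congr' ?_
  obtain ⟨K, hK⟩ := exists_nat_ge |x|
  filter_upwards [Filter.eventually_ge_atTop K] with N hN
  have hx : |x| ≤ N := hK.trans (Nat.cast_le.2 hN)
  rw [abs_le] at hx
  rw [clamp, min_eq_right hx.2, max_eq_right hx.1]

theorem PosAssoc.associated {Ω ι : Type*} [MeasurableSpace Ω] {P : Measure Ω}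
    [IsFiniteMeasure P] {X : Ω → ι → ℝ} (hX : Measurable X) (h : PosAssoc (P.map X)) :
    Associated P X := by
  intro f g hf hg hfm hgm hfi hgi hfgi
  have lim : ∀ {u : Ω → ℝ} {U : ℕ → Ω → ℝ}, Integrable u P → (∀ N, Measurable (U N)) →
      (∀ N ω, |U N ω| ≤ |u ω|) → (∀ ω, Filter.Tendsto (fun N => U N ω) Filter.atTop (nhds (u ω))) →
      Filter.Tendsto (fun N => ∫ ω, U N ω ∂P) Filter.atTop (nhds (∫ ω, u ω ∂P)) :=
    fun hu hU hle ht => tendsto_integral_of_dominated_convergence (fun ω => |_|)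
      (fun N => (hU N).aestronglyMeasurable) hu.abs
      (fun N => ae_of_all _ (hle N)) (ae_of_all _ ht)
  have mf : ∀ N, Measurable fun ω => clamp N (f (X ω)) :=
    fun N => (measurable_clamp N).comp (hfm.comp hX)
  have mg : ∀ N, Measurable fun ω => clamp N (g (X ω)) :=
    fun N => (measurable_clamp N).comp (hgm.comp hX)
  have l1 := lim hfi mf (fun N ω => abs_clamp_le_abs N _) (fun ω => tendsto_clamp _)
  have l2 := lim hgi mg (fun N ω => abs_clamp_le_abs N _) (fun ω => tendsto_clamp _)
  have l3 := lim (U := fun N ω => clamp N (f (X ω)) * clamp N (g (X ω))) hfgi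
    (fun N => (mf N).mul (mg N))
    (fun N ω => by
      simp only [abs_mul]
      exact mul_le_mul (abs_clamp_le_abs N _) (abs_clamp_le_abs N _) (abs_nonneg _) (abs_nonneg _))
    (fun ω => (tendsto_clamp _).mul (tendsto_clamp _))
  refine le_of_tendsto_of_tendsto' (l1.mul l2) l3 fun N => ?_
  have hfN : Measurable fun x => clamp N (f x) := (measurable_clamp N).comp hfm
  have hgN : Measurable fun x => clamp N (g x) := (measurable_clamp N).comp hgm
  have := h (fun x => clamp N (f x)) (fun x => clamp N (g x)) ((monotone_clamp N).comp hf)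
    ((monotone_clamp N).comp hg) hfN hgN
    ⟨N, fun x => abs_clamp_le N _⟩ ⟨N, fun x => abs_clamp_le N _⟩
  rwa [integral_map hX.aemeasurable hfN.aestronglyMeasurable,
    integral_map hX.aemeasurable hgN.aestronglyMeasurable,
    integral_map_mul hX hfN hgN] at this

/-- Two decreasing events of an associated measure are positively correlated. -/
theorem PosAssoc.mul_le_inter {E : Type*} [Preorder E] [MeasurableSpace E] {ν : Measure E}
    [IsProbabilityMeasure ν] (h : PosAssoc ν) {A B : Set E} (hA : IsLowerSet A) (hB : IsLowerSet B)
    (hAm : MeasurableSet A) (hBm : MeasurableSet B) : ν A * ν B ≤ ν (A ∩ B) := by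
  -- minus the indicator of a lower set is increasing
  have bd : ∀ S : Set E, ∃ C : ℝ, ∀ x, |-(S.indicator (fun _ => (1 : ℝ)) x)| ≤ C := fun S =>
    ⟨1, fun x => by by_cases hx : x ∈ S <;> simp [hx]⟩
  have mono : ∀ {S : Set E}, IsLowerSet S →
      Monotone fun x => -(S.indicator (fun _ => (1 : ℝ)) x) := by
    intro S hS x y hxy
    by_cases hy : y ∈ S
    · simp [hy, hS hxy hy]
    · by_cases hx : x ∈ S <;> simp [hx, hy]
  have := h _ _ (mono hA) (mono hB) ((measurable_const.indicator hAm).neg)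
    ((measurable_const.indicator hBm).neg) (bd A) (bd B)
  have e : ∀ x, -(A.indicator (fun _ => (1 : ℝ)) x) * -(B.indicator (fun _ => (1 : ℝ)) x) =
      (A ∩ B).indicator (fun _ => (1 : ℝ)) x := by
    intro x
    by_cases hx : x ∈ A <;> by_cases hy : x ∈ B <;> simp [hx, hy]
  simp only [e, integral_neg, integral_indicator_const _ hAm, integral_indicator_const _ hBm,
    integral_indicator_const _ (hAm.inter hBm), smul_eq_mul, mul_one, neg_mul_neg] at this
  rw [← ENNReal.ofReal_toReal (measure_ne_top ν A), ← ENNReal.ofReal_toReal (measure_ne_top ν B),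
    ← ENNReal.ofReal_mul ENNReal.toReal_nonneg, ← ENNReal.ofReal_toReal (measure_ne_top ν (A ∩ B))]
  exact ENNReal.ofReal_le_ofReal this

/-- The joint distribution function of an associated vector dominates the product of its marginal
distribution functions. -/
theorem PosAssoc.prod_le_forall {ι : Type*} {ν : Measure (ι → ℝ)}
    [IsProbabilityMeasure ν] (h : PosAssoc ν) (T : Finset ι) {L : ι → Set ℝ}
    (hL : ∀ i, IsLowerSet (L i)) (hm : ∀ i, MeasurableSet (L i)) :
    ∏ i ∈ T, ν {x | x i ∈ L i} ≤ ν {x | ∀ i ∈ T, x i ∈ L i} := by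
  classical
  induction T using Finset.induction_on with
  | empty => simp
  | insert j T hj ih =>
    rw [Finset.prod_insert hj]
    have e : {x : ι → ℝ | ∀ i ∈ insert j T, x i ∈ L i} =
        {x | x j ∈ L j} ∩ {x | ∀ i ∈ T, x i ∈ L i} := by
      ext x; simp
    rw [e]
    refine (mul_le_mul_right ih _).trans (h.mul_le_inter ?_ ?_ ?_ ?_)
    · exact fun x y hxy hx => hL j (hxy j) hx
    · exact fun x y hxy hx i hi => hL i (hxy i) (hx i hi)
    · exact measurable_pi_apply j (hm j)
    · have : {x : ι → ℝ | ∀ i ∈ T, x i ∈ L i} = ⋂ i ∈ T, {x | x i ∈ L i} := by ext; simp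
      rw [this]
      exact Finset.measurableSet_biInter T fun i _ => measurable_pi_apply i (hm i)

/-! ### Exchangeability of balanced random routing -/

section

theorem pmf_map_equiv_apply {β γ : Type*} (p : PMF β) (e : β ≃ γ) (y : γ) :
    p.map e y = p (e.symm y) := by
  classical
  rw [PMF.map_apply, tsum_eq_single (e.symm y)]
  · simp
  · intro b hb
    rw [if_neg]
    rintro rfl
    simp at hb

theorem mem_of_mem_support_uniformOr {β : Type*} {S : Finset β} {d y : β} (hS : S.Nonempty)
    (hy : y ∈ (uniformOr S d).support) : y ∈ S := by
  classical
  rw [uniformOr, dif_pos hS] at hy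
  simpa using hy

theorem uniformOr_map_equiv {β : Type*} (S : Finset β) (d : β) (e : β ≃ β) :
    (uniformOr S d).map e = uniformOr (S.map e.toEmbedding) (e d) := by
  classical
  by_cases hS : S.Nonempty
  · have hS' : (S.map e.toEmbedding).Nonempty := by simpa using hS
    rw [uniformOr, uniformOr, dif_pos hS, dif_pos hS']
    ext y
    rw [pmf_map_equiv_apply, PMF.uniformOfFinset_apply, PMF.uniformOfFinset_apply,
      Finset.card_map]
    simp [Finset.mem_map_equiv]
  · have hS' : ¬ (S.map e.toEmbedding).Nonempty := by simpa using hS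
    rw [uniformOr, uniformOr, dif_neg hS, dif_neg hS', PMF.pure_map]

variable {m : ℕ}

theorem levelVector_comp (q : ℕ) (T : Finset (Fin m)) (σ : Equiv.Perm (Fin m)) :
    levelVector q T ∘ σ = levelVector q (T.map σ.symm.toEmbedding) := by
  funext i
  simp [levelVector, Finset.mem_map_equiv]

/-- A uniformly random subset of `A` of given size is carried by a permutation of the servers to a
uniformly random subset of the image of `A`. -/
theorem uniformOr_powersetCard_levelVector_comp (q r : ℕ) (A : Finset (Fin m))
    (σ : Equiv.Perm (Fin m)) :
    ((uniformOr (Finset.powersetCard r A) ∅).map (levelVector q)).map (· ∘ σ) =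
      (uniformOr (Finset.powersetCard r (A.map σ.symm.toEmbedding)) ∅).map (levelVector q) := by
  have h := uniformOr_map_equiv (Finset.powersetCard r A) ∅ σ.symm.finsetCongr
  have e : (Finset.powersetCard r A).map σ.symm.finsetCongr.toEmbedding =
      Finset.powersetCard r (A.map σ.symm.toEmbedding) := by
    rw [Finset.powersetCard_map]
    rfl
  have e' : σ.symm.finsetCongr (∅ : Finset (Fin m)) = ∅ := by simp
  rw [e, e'] at h
  rw [← h, PMF.map_comp, PMF.map_comp]
  congr 1
  funext T
  exact levelVector_comp q T σ

theorem placementLaw_map_comp (b : ℕ) (σ : Equiv.Perm (Fin m)) :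
    (placementLaw m b).map (· ∘ σ) = placementLaw m b := by
  rw [placementLaw, uniformOr_powersetCard_levelVector_comp]
  simp

theorem extraServers_comp (k : ℕ) (a : Fin m → ℕ) (σ : Equiv.Perm (Fin m)) :
    extraServers k (a ∘ σ) = (extraServers k a).map σ.symm.toEmbedding := by
  ext i
  simp [extraServers, Finset.mem_map_equiv]

theorem balancedRandom_map_comp (k : ℕ) (a : Fin m → ℕ) (σ : Equiv.Perm (Fin m)) :
    (balancedRandom k a).map (· ∘ σ) = balancedRandom k (a ∘ σ) := by
  rw [balancedRandom, uniformOr_powersetCard_levelVector_comp, balancedRandom, extraServers_comp]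

/-- The typical balanced random routing vector is exchangeable. -/
theorem typicalBR_map_comp (α : ℕ → ℕ) (k : ℕ) (σ : Equiv.Perm (Fin m)) :
    (typicalBR m α k).map (· ∘ σ) = typicalBR m α k := by
  rw [typicalBR, PMF.map_bind]
  simp_rw [balancedRandom_map_comp]
  conv_rhs => rw [← placementLaw_map_comp (α k) σ, PMF.bind_map]
  rfl

theorem typicalBR_comp_apply (α : ℕ → ℕ) (k : ℕ) (σ : Equiv.Perm (Fin m)) (r : Fin m → ℕ) :
    typicalBR m α k (r ∘ σ) = typicalBR m α k r := by
  have h := pmf_map_equiv_apply (typicalBR m α k) (Equiv.arrowCongr σ.symm (Equiv.refl ℕ)) (r ∘ σ)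
  have e : ⇑(Equiv.arrowCongr σ.symm (Equiv.refl ℕ)) = fun x : Fin m → ℕ => x ∘ σ := by
    funext x; rfl
  rw [e, typicalBR_map_comp] at h
  rw [h]
  congr 1
  funext i
  simp

theorem exists_of_mem_support_powersetCard {q l : ℕ} {A : Finset (Fin m)} (hl : l ≤ A.card)
    {r : Fin m → ℕ}
    (hr : r ∈ ((uniformOr (Finset.powersetCard l A) ∅).map (levelVector q)).support) :
    ∃ T ⊆ A, T.card = l ∧ r = levelVector q T := by
  rw [PMF.mem_support_map_iff] at hr
  obtain ⟨T, hT, rfl⟩ := hr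
  have := mem_of_mem_support_uniformOr (Finset.powersetCard_nonempty.2 hl) hT
  rw [Finset.mem_powersetCard] at this
  exact ⟨T, this.1, this.2, rfl⟩

theorem sum_levelVector (q : ℕ) (T : Finset (Fin m)) :
    ∑ i, levelVector q T i = m * q + T.card := by
  have : ∀ i, levelVector q T i = q + if i ∈ T then 1 else 0 := by
    intro i; unfold levelVector; split <;> rfl
  simp [this, Finset.sum_add_distrib]

theorem placementLaw_support (hm : 0 < m) {b : ℕ} {a : Fin m → ℕ}
    (ha : a ∈ (placementLaw m b).support) :
    ∃ T : Finset (Fin m), T.card = b % m ∧ a = levelVector (b / m) T := by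
  obtain ⟨T, -, h⟩ := exists_of_mem_support_powersetCard
    (by simpa using (Nat.mod_lt b hm).le) ha
  exact ⟨T, h⟩

/-- What the placement of at least `k` blocks offers to a request for `k` chunks: at least
`⌊k/m⌋` blocks on each server, and enough servers with a further block. -/
theorem placementLaw_support_facts (hm : 0 < m) {b k : ℕ} (hk : k ≤ b) {a : Fin m → ℕ}
    (ha : a ∈ (placementLaw m b).support) :
    (∀ i, k / m ≤ a i) ∧ k % m ≤ (extraServers k a).card ∧ k ≤ ∑ i, a i := by
  obtain ⟨T, hT, rfl⟩ := placementLaw_support hm ha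
  have hq : k / m ≤ b / m := Nat.div_le_div_right hk
  have hlev : ∀ i, b / m ≤ levelVector (b / m) T i := by
    intro i; unfold levelVector; split <;> omega
  refine ⟨fun i => hq.trans (hlev i), ?_, ?_⟩
  · rcases hq.lt_or_eq with h | h
    · have : extraServers k (levelVector (b / m) T) = Finset.univ := by
        ext i
        simpa [extraServers] using h.trans_le (hlev i)
      rw [this]
      simpa using (Nat.mod_lt k hm).le
    · have : extraServers k (levelVector (b / m) T) = T := by
        ext i
        simp only [extraServers, levelVector, h, Finset.mem_filter, Finset.mem_univ, true_and]
        split <;> simp_all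
      rw [this, hT]
      have h1 := Nat.div_add_mod k m
      have h2 := Nat.div_add_mod b m
      rw [h] at h1
      omega
  · rw [sum_levelVector, hT, Nat.div_add_mod]
    exact hk

theorem balancedRandom_support {k : ℕ} {a r : Fin m → ℕ} (h : k % m ≤ (extraServers k a).card)
    (hr : r ∈ (balancedRandom k a).support) :
    ∃ T ⊆ extraServers k a, T.card = k % m ∧ r = levelVector (k / m) T :=
  exists_of_mem_support_powersetCard h hr

theorem typicalBR_support (hm : 0 < m) {α : ℕ → ℕ} {k : ℕ} (hk : k ≤ α k) {r : Fin m → ℕ}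
    (hr : r ∈ (typicalBR m α k).support) :
    ∃ T : Finset (Fin m), T.card = k % m ∧ r = levelVector (k / m) T := by
  rw [typicalBR, PMF.mem_support_bind_iff] at hr
  obtain ⟨a, ha, hr⟩ := hr
  obtain ⟨T, -, h⟩ := balancedRandom_support (placementLaw_support_facts hm hk ha).2.1 hr
  exact ⟨T, h⟩

/-! ### The number of blocks requested from one server -/

theorem typicalBR_marginal_eq (α : ℕ → ℕ) (k : ℕ) (i j : Fin m) :
    (typicalBR m α k).map (fun r => r i) = (typicalBR m α k).map (fun r => r j) := by
  conv_rhs => rw [← typicalBR_map_comp α k (Equiv.swap i j), PMF.map_comp]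
  congr 1
  funext r
  simp

theorem pmf_map_apply_eq_tsum {β γ : Type*} [DecidableEq γ] (p : PMF β) (f : β → γ) (y : γ) :
    p.map f y = ∑' b, p b * if f b = y then 1 else 0 := by
  classical
  rw [PMF.map_apply]
  refine tsum_congr fun b => ?_
  by_cases h : f b = y
  · simp [h]
  · simp [h, Ne.symm h]

theorem typicalBR_marginal_succ (hm : 0 < m) {α : ℕ → ℕ} {k : ℕ} (hk : k ≤ α k) (i : Fin m) :
    (typicalBR m α k).map (fun r => r i) (k / m + 1) = ((k % m : ℕ) : ℝ≥0∞) / m := by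
  have hm0 : (m : ℝ≥0∞) ≠ 0 := by exact_mod_cast hm.ne'
  rw [ENNReal.eq_div_iff hm0 (ENNReal.natCast_ne_top m)]
  -- by exchangeability, `m` times the left side is the mean number of servers with an extra block
  have h1 : (m : ℝ≥0∞) * (typicalBR m α k).map (fun r => r i) (k / m + 1) =
      ∑ j : Fin m, (typicalBR m α k).map (fun r => r j) (k / m + 1) := by
    simp_rw [typicalBR_marginal_eq α k _ i]
    simp
  rw [h1]
  simp_rw [pmf_map_apply_eq_tsum]
  rw [← Summable.tsum_finsetSum fun _ _ => ENNReal.summable]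
  have h2 : ∀ r : Fin m → ℕ, ∑ j, typicalBR m α k r * (if r j = k / m + 1 then 1 else 0) =
      typicalBR m α k r * ((k % m : ℕ) : ℝ≥0∞) := by
    intro r
    by_cases hr : r ∈ (typicalBR m α k).support
    · obtain ⟨T, hT, rfl⟩ := typicalBR_support hm hk hr
      rw [← Finset.mul_sum, ← hT]
      congr 1
      simp [levelVector]
    · rw [PMF.mem_support_iff, not_not] at hr
      simp [hr]
  simp_rw [h2]
  rw [ENNReal.tsum_mul_right, PMF.tsum_coe, one_mul]

theorem typicalBR_marginal_of_ne (hm : 0 < m) {α : ℕ → ℕ} {k : ℕ} (hk : k ≤ α k) (i : Fin m)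
    {l : ℕ} (h1 : l ≠ k / m + 1) (h2 : l ≠ k / m) :
    (typicalBR m α k).map (fun r => r i) l = 0 := by
  rw [PMF.apply_eq_zero_iff, PMF.mem_support_map_iff]
  rintro ⟨r, hr, h⟩
  obtain ⟨T, -, rfl⟩ := typicalBR_support hm hk hr
  simp only [levelVector] at h
  split at h
  · exact h1 h.symm
  · exact h2 h.symm

theorem toReal_typicalBR_marginal_succ (hm : 0 < m) {α : ℕ → ℕ} {k : ℕ} (hk : k ≤ α k)
    (i : Fin m) :
    ((typicalBR m α k).map (fun r => r i) (k / m + 1)).toReal = (k : ℝ) / m - (k / m : ℕ) := by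
  have hm0 : (m : ℝ) ≠ 0 := by exact_mod_cast hm.ne'
  rw [typicalBR_marginal_succ hm hk, ENNReal.toReal_div]
  simp only [ENNReal.toReal_natCast]
  have h : ((m * (k / m) + k % m : ℕ) : ℝ) = k := by rw [Nat.div_add_mod]
  rw [Nat.cast_add, Nat.cast_mul] at h
  field_simp
  linarith

theorem toReal_typicalBR_marginal_self (hm : 0 < m) {α : ℕ → ℕ} {k : ℕ} (hk : k ≤ α k)
    (i : Fin m) :
    ((typicalBR m α k).map (fun r => r i) (k / m)).toReal = 1 - (k : ℝ) / m + (k / m : ℕ) := by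
  have h := PMF.tsum_coe ((typicalBR m α k).map (fun r => r i))
  rw [tsum_eq_sum (s := {k / m, k / m + 1}), Finset.sum_pair (by omega)] at h
  · have h' := congrArg ENNReal.toReal h
    rw [ENNReal.toReal_add (PMF.apply_ne_top _ _) (PMF.apply_ne_top _ _),
      toReal_typicalBR_marginal_succ hm hk, ENNReal.toReal_one] at h'
    linarith
  · intro l hl
    simp only [Finset.mem_insert, Finset.mem_singleton, not_or] at hl
    exact typicalBR_marginal_of_ne hm hk i hl.2 hl.1

theorem toReal_bind_typicalBR_marginal (π : PMF ℕ) (α : ℕ → ℕ) (i : Fin m) (l : ℕ) :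
    (((π.bind (typicalBR m α)).map (fun r => r i)) l).toReal =
      ∑' k, (π k).toReal * ((typicalBR m α k).map (fun r => r i) l).toReal := by
  rw [PMF.map_bind, PMF.bind_apply, ENNReal.tsum_toReal_eq
    fun k => ENNReal.mul_ne_top (PMF.apply_ne_top _ _) (PMF.apply_ne_top _ _)]
  simp_rw [ENNReal.toReal_mul]

/-- Moving the common endpoint `b` from the second sum to the first one, and dropping the endpoint
`a`, reconciles the blocks of equal quotient `k / m` with the ranges used in `cavityMass`. -/
theorem sum_Ico_add_sum_Ico {a b d : ℕ} (hab : a < b) (hbd : b < d) {u v : ℕ → ℝ} (hu : u a = 0)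
    (huv : u b = v b) :
    ∑ k ∈ Finset.Ico a b, u k + ∑ k ∈ Finset.Ico b d, v k =
      ∑ k ∈ Finset.Ioc a b, u k + ∑ k ∈ Finset.Ioo b d, v k := by
  rw [← Finset.Ioo_insert_left hab, ← Finset.Ioo_insert_left hbd, ← Finset.Ioo_insert_right hab,
    Finset.sum_insert (by simp), Finset.sum_insert (by simp), Finset.sum_insert (by simp), hu, huv]
  ring

/-- The number of blocks that balanced random routing requests from a given server has the mass
function of the service requirements of the Cavity Queue. -/
theorem toReal_marginal_eq_cavityMass (hm : 0 < m) (π : PMF ℕ) {α : ℕ → ℕ} (hα : ∀ k, k ≤ α k)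
    (i : Fin m) (l : ℕ) :
    (((π.bind (typicalBR m α)).map (fun r => r i)) l).toReal = cavityMass m π l := by
  have hm0 : (m : ℝ) ≠ 0 := by exact_mod_cast hm.ne'
  rw [toReal_bind_typicalBR_marginal]
  cases l with
  | zero =>
    -- the number of blocks can be zero only for `k < m`, with probability `1 - k / m`
    rw [tsum_eq_sum (s := Finset.range m)]
    · have hs : ∑' k, (π k).toReal = 1 := by
        rw [← ENNReal.tsum_toReal_eq fun k => PMF.apply_ne_top _ _, PMF.tsum_coe,
          ENNReal.toReal_one]
      have hsum : Summable fun k => (π k).toReal :=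
        ENNReal.summable_toReal (by rw [PMF.tsum_coe]; exact ENNReal.one_ne_top)
      rw [← hsum.sum_add_tsum_nat_add (m + 1)] at hs
      have e : ∀ k ∈ Finset.range m,
          (π k).toReal * ((typicalBR m α k).map (fun r => r i) 0).toReal =
            (π k).toReal - (k : ℝ) / m * (π k).toReal := by
        intro k hk
        have h0 : k / m = 0 := Nat.div_eq_of_lt (Finset.mem_range.1 hk)
        have := toReal_typicalBR_marginal_self hm (hα k) i
        rw [h0] at this
        rw [this]
        push_cast
        ring
      rw [Finset.sum_congr rfl e, Finset.sum_sub_distrib, cavityMass]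
      have e2 : ∑ k ∈ Finset.Icc 1 m, (k : ℝ) / m * (π k).toReal =
          ∑ k ∈ Finset.range (m + 1), (k : ℝ) / m * (π k).toReal := by
        symm
        rw [Finset.sum_range_eq_add_Ico _ (Nat.succ_pos m)]
        simp only [Nat.cast_zero, zero_div, zero_mul, zero_add]
        rfl
      rw [e2, Finset.sum_range_succ, div_self hm0]
      rw [Finset.sum_range_succ] at hs
      simp_rw [add_comm (m + 1)]
      linarith
    · intro k hk
      rw [typicalBR_marginal_of_ne hm (hα k) i (Nat.succ_ne_zero _).symm]
      · simp
      · have := Nat.div_pos (not_lt.1 (fun h => hk (Finset.mem_range.2 h))) hm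
        omega
  | succ j =>
    -- `j + 1` blocks are requested either as `k / m + 1` or as `k / m`
    have hsplit : ∀ {a k : ℕ}, k ∈ Finset.Ico (a * m) ((a + 1) * m) → k / m = a := by
      intro a k hk
      rw [Finset.mem_Ico] at hk
      exact Nat.div_eq_of_lt_le hk.1 hk.2
    have hab : j * m < (j + 1) * m := Nat.mul_lt_mul_of_pos_right (by omega) hm
    have hbd : (j + 1) * m < (j + 2) * m := Nat.mul_lt_mul_of_pos_right (by omega) hm
    rw [tsum_eq_sum (s := Finset.Ico (j * m) ((j + 2) * m)),
      ← Finset.sum_Ico_consecutive _ hab.le hbd.le, cavityMass]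
    · rw [← sum_Ico_add_sum_Ico hab hbd]
      · congr 1
        · refine Finset.sum_congr rfl fun k hk => ?_
          have := toReal_typicalBR_marginal_succ hm (hα k) i
          rw [hsplit hk] at this
          rw [this, mul_comm]
        · refine Finset.sum_congr rfl fun k hk => ?_
          have := toReal_typicalBR_marginal_self hm (hα k) i
          rw [hsplit hk] at this
          rw [this, mul_comm]
          push_cast
          ring
      · push_cast
        field_simp
        simp
      · push_cast
        field_simp
        ring
    · intro k hk
      rw [typicalBR_marginal_of_ne hm (hα k) i]
      · simp
      · intro h
        have : k / m = j := by omega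
        refine hk (Finset.mem_Ico.2 ?_)
        have h1 := Nat.div_mul_le_self k m
        have h2 := Nat.lt_mul_div_succ k hm
        rw [this] at h1 h2
        exact ⟨h1, by nlinarith⟩
      · intro h
        have : k / m = j + 1 := h.symm
        refine hk (Finset.mem_Ico.2 ?_)
        have h1 := Nat.div_mul_le_self k m
        have h2 := Nat.lt_mul_div_succ k hm
        rw [this] at h1 h2
        exact ⟨by nlinarith, by nlinarith⟩

end

/-! ### Greedy routing vectors and symmetric convex functions -/

section

variable {m : ℕ}

/-- No block of `s` placed above `r` can be moved to a server of lower level among those where `r`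
exceeds `s`: this is what `s` inherits from being chosen greedily for the workload `w` when `r` is
another feasible choice. -/
def Greedy (c : ℝ) (w : Fin m → ℝ) (s r : Fin m → ℕ) : Prop :=
  ∀ i j, r i < s i → s j < r j → w i + c * ((s i : ℝ) - 1) ≤ w j + c * (s j : ℝ)

theorem exists_lt_of_sum_eq {s r : Fin m → ℕ} (h : ∑ i, s i = ∑ i, r i) {i : Fin m}
    (hi : r i < s i) : ∃ j, s j < r j := by
  by_contra! hc
  exact absurd h (Finset.sum_lt_sum (fun j _ => hc j) ⟨i, Finset.mem_univ _, hi⟩).ne'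

theorem le_delay {c : ℝ} {w : Fin m → ℝ} {s : Fin m → ℕ} {i : Fin m} (hi : 0 < s i) :
    w i + c * (s i : ℝ) ≤ delay c w s := by
  have h : (Finset.univ.filter fun i => 0 < s i).Nonempty := ⟨i, by simpa using hi⟩
  rw [delay, dif_pos h]
  exact Finset.le_sup' (fun i => w i + c * (s i : ℝ)) (by simpa using hi)

theorem delay_le {c : ℝ} {w : Fin m → ℝ} {s : Fin m → ℕ} {y : ℝ} (hs : s ≠ 0)
    (h : ∀ i, 0 < s i → w i + c * (s i : ℝ) ≤ y) : delay c w s ≤ y := by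
  have hne : (Finset.univ.filter fun i => 0 < s i).Nonempty := by
    obtain ⟨i, hi⟩ := Function.ne_iff.1 hs
    exact ⟨i, by simpa using Nat.pos_of_ne_zero hi⟩
  rw [delay, dif_pos hne, Finset.sup'_le_iff]
  intro i hi
  exact h i (by simpa using hi)

theorem delay_zero (c : ℝ) (w : Fin m → ℝ) : delay c w 0 = 0 := by
  simp [delay]

/-- Moving blocks to higher levels increases the delay. -/
theorem Greedy.delay_le {c : ℝ} (hc : 0 < c) {w : Fin m → ℝ} {s r : Fin m → ℕ}
    (h : Greedy c w s r) (hsum : ∑ i, s i = ∑ i, r i) : delay c w s ≤ delay c w r := by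
  by_cases hs : s = 0
  · have hr : r = 0 := by
      subst hs
      funext i
      have := hsum.symm
      simp only [Pi.zero_apply, Finset.sum_const_zero, Finset.sum_eq_zero_iff, Finset.mem_univ,
        true_imp_iff] at this
      exact this i
    rw [hs, hr]
  · refine DataCluster.delay_le hs fun i hi => ?_
    by_cases hri : r i < s i
    · obtain ⟨j, hj⟩ := exists_lt_of_sum_eq hsum hri
      refine le_trans ?_ (le_delay (Nat.zero_lt_of_lt hj))
      have h1 := h i j hri hj
      have h2 : (s j : ℝ) + 1 ≤ r j := by exact_mod_cast hj
      nlinarith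
    · rw [not_lt] at hri
      refine le_trans ?_ (le_delay (hi.trans_le hri))
      have h2 : (s i : ℝ) ≤ r i := by exact_mod_cast hri
      nlinarith

/-- The cone of test functions: increasing, symmetric and convex functions of the workload vector
with values in `[0, ∞]`. -/
structure SymConvex (φ : (Fin m → ℝ) → ℝ≥0∞) : Prop where
  mono : Monotone φ
  symm : ∀ (σ : Equiv.Perm (Fin m)) x, φ (x ∘ σ) = φ x
  convex : ∀ x y (a b : ℝ), 0 ≤ a → 0 ≤ b → a + b = 1 →
    φ (a • x + b • y) ≤ ENNReal.ofReal a * φ x + ENNReal.ofReal b * φ y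
  measurable : Measurable φ

/-- Moving an amount `c` from a coordinate to another one that is lower by at least `c` decreases a
symmetric convex function: the result is a convex combination of the vector and a transposition of
it. -/
theorem SymConvex.le_of_transfer {φ : (Fin m → ℝ) → ℝ≥0∞} (hφ : SymConvex φ) {c : ℝ} (hc : 0 < c)
    {x y : Fin m → ℝ} {i j : Fin m} (hij : i ≠ j) (hx : x i + c ≤ x j) (hi : y i = x i + c)
    (hj : y j = x j - c) (ho : ∀ l, l ≠ i → l ≠ j → y l = x l) : φ y ≤ φ x := by
  have hd : 0 < x j - x i := by linarith
  set b : ℝ := c / (x j - x i) with hb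
  have hb0 : 0 ≤ b := by positivity
  have hb1 : b ≤ 1 := by rw [hb, div_le_one hd]; linarith
  have hbm : b * (x j - x i) = c := div_mul_cancel₀ _ hd.ne'
  have hy : y = (1 - b) • x + b • (x ∘ Equiv.swap i j) := by
    funext l
    simp only [Pi.add_apply, Pi.smul_apply, Function.comp_apply, smul_eq_mul]
    by_cases hli : l = i
    · subst hli
      rw [Equiv.swap_apply_left, hi]
      linarith
    · by_cases hlj : l = j
      · subst hlj
        rw [Equiv.swap_apply_right, hj]
        linarith
      · rw [Equiv.swap_apply_of_ne_of_ne hli hlj, ho l hli hlj]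
        ring
  rw [hy]
  refine (hφ.convex x _ (1 - b) b (by linarith) hb0 (by ring)).trans ?_
  rw [hφ.symm, ← add_mul, ← ENNReal.ofReal_add (by linarith) hb0]
  simp

/-- A symmetric convex function of the levels is smallest for the greedy choice: `r` turns into `s`
by moving single blocks, each to a server that is lower by at least the size of a block. -/
theorem Greedy.symConvex_le {c : ℝ} (hc : 0 < c) {φ : (Fin m → ℝ) → ℝ≥0∞} (hφ : SymConvex φ)
    {w : Fin m → ℝ} {s r : Fin m → ℕ} (h : Greedy c w s r) (hsum : ∑ i, s i = ∑ i, r i) :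
    φ (fun i => w i + c * (s i : ℝ)) ≤ φ (fun i => w i + c * (r i : ℝ)) := by
  obtain ⟨D, hD⟩ : ∃ D, ∑ i, (s i - r i) = D := ⟨_, rfl⟩
  induction D using Nat.strong_induction_on generalizing r with
  | _ D ih =>
    by_cases hex : ∃ i, r i < s i
    · obtain ⟨i, hi⟩ := hex
      obtain ⟨j, hj⟩ := exists_lt_of_sum_eq hsum hi
      have hij : i ≠ j := by rintro rfl; omega
      -- move one block of `r` from `j` to `i`
      set t : Fin m → ℕ := fun l => if l = i then r l + 1 else if l = j then r l - 1 else r l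
        with ht
      have hti : t i = r i + 1 := by simp [ht]
      have htj : t j = r j - 1 := by simp [ht, hij.symm]
      have hto : ∀ l, l ≠ i → l ≠ j → t l = r l := by intro l h1 h2; simp [ht, h1, h2]
      have hlt : ∀ l, t l < s l → r l < s l := by
        intro l hl
        by_cases h1 : l = i
        · exact h1 ▸ hi
        · by_cases h2 : l = j
          · subst h2; omega
          · rwa [hto l h1 h2] at hl
      have hgt : ∀ l, s l < t l → s l < r l := by
        intro l hl
        by_cases h1 : l = i
        · subst h1; omega
        · by_cases h2 : l = j
          · exact h2 ▸ hj
          · rwa [hto l h1 h2] at hl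
      have hG : Greedy c w s t := fun a b ha hb => h a b (hlt a ha) (hgt b hb)
      have hst : ∑ l, s l = ∑ l, t l := by
        rw [hsum]
        have e : ∀ l, t l + (if l = j then 1 else 0) = r l + if l = i then 1 else 0 := by
          intro l
          by_cases h1 : l = i
          · subst h1; simp [hti, hij]
          · by_cases h2 : l = j
            · subst h2; simp [htj, h1]; omega
            · simp [hto l h1 h2, h1, h2]
        have := Finset.sum_congr (rfl : (Finset.univ : Finset (Fin m)) = _) fun l _ => e l
        simp only [Finset.sum_add_distrib, Finset.sum_ite_eq', Finset.mem_univ, if_true] at this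
        omega
      have hdec : ∑ l, (s l - t l) < D := by
        rw [← hD]
        refine Finset.sum_lt_sum (fun l _ => ?_) ⟨i, Finset.mem_univ _, by omega⟩
        by_cases h1 : l = i
        · subst h1; omega
        · by_cases h2 : l = j
          · subst h2; omega
          · rw [hto l h1 h2]
      refine (ih _ hdec hG hst rfl).trans
        (hφ.le_of_transfer hc hij (i := i) (j := j) ?_ ?_ ?_ ?_)
      · have h1 := h i j hi hj
        have h2 : (r i : ℝ) + 1 ≤ s i := by exact_mod_cast hi
        have h3 : (s j : ℝ) + 1 ≤ r j := by exact_mod_cast hj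
        nlinarith
      · simp only [hti]; push_cast; ring
      · have : 1 ≤ r j := by omega
        simp only [htj, Nat.cast_sub this]; push_cast; ring
      · intro l h1 h2
        simp only [hto l h1 h2]
    · push Not at hex
      have : s = r := by
        funext l
        have := (Finset.sum_eq_sum_iff_of_le fun l _ => hex l).1 hsum
        exact this l (Finset.mem_univ l)
      rw [this]

/-! ### Batch sampling and water-filling are greedy -/

theorem mem_argminOn {A : Finset (Fin m)} {w : Fin m → ℝ} {i : Fin m} :
    i ∈ argminOn A w ↔ i ∈ A ∧ ∀ j ∈ A, w i ≤ w j := by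
  simp [argminOn]

theorem argminOn_nonempty {A : Finset (Fin m)} (hA : A.Nonempty) (w : Fin m → ℝ) :
    (argminOn A w).Nonempty := by
  obtain ⟨i, hi, h⟩ := A.exists_min_image w hA
  exact ⟨i, mem_argminOn.2 ⟨hi, h⟩⟩

/-- The selected servers are no more loaded than the others of `A`. -/
theorem leastLoaded_support {w : Fin m → ℝ} {A : Finset (Fin m)} {l : ℕ} (hl : l ≤ A.card)
    {T : Finset (Fin m)} (hT : T ∈ (leastLoaded w A l).support) :
    T ⊆ A ∧ T.card = l ∧ ∀ i ∈ T, ∀ j ∈ A \ T, w i ≤ w j := by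
  induction l generalizing T with
  | zero =>
    simp only [leastLoaded, PMF.support_pure, Set.mem_singleton_iff] at hT
    subst hT
    simp
  | succ l ih =>
    rw [leastLoaded, PMF.mem_support_bind_iff] at hT
    obtain ⟨T', hT', hT⟩ := hT
    obtain ⟨h1, h2, h3⟩ := ih (by omega) hT'
    have hne : (A \ T').Nonempty := by
      rw [← Finset.card_pos, Finset.card_sdiff_of_subset h1]
      omega
    have := mem_of_mem_support_uniformOr ((argminOn_nonempty hne w).image _) hT
    rw [Finset.mem_image] at this
    obtain ⟨i, hi, rfl⟩ := this
    rw [mem_argminOn, Finset.mem_sdiff] at hi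
    refine ⟨Finset.insert_subset hi.1.1 h1, by rw [Finset.card_insert_of_notMem hi.1.2, h2], ?_⟩
    intro a ha b hb
    simp only [Finset.mem_sdiff, Finset.mem_insert, not_or] at hb
    rcases Finset.mem_insert.1 ha with rfl | ha
    · exact hi.2 b (Finset.mem_sdiff.2 ⟨hb.1, hb.2.2⟩)
    · exact h3 a ha b (Finset.mem_sdiff.2 ⟨hb.1, hb.2.2⟩)

/-- The last block placed on any server was placed at a level not above the present level of any
server with blocks left, because levels only grow. -/
theorem waterFilling_support {c : ℝ} (hc : 0 < c) {w : Fin m → ℝ} {a : Fin m → ℕ} {l : ℕ}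
    (hl : l ≤ ∑ i, a i) {s : Fin m → ℕ} (hs : s ∈ (waterFilling c w a l).support) :
    (∀ i, s i ≤ a i) ∧ ∑ i, s i = l ∧
      ∀ i j, 0 < s i → s j < a j → w i + c * ((s i : ℝ) - 1) ≤ w j + c * (s j : ℝ) := by
  induction l generalizing s with
  | zero =>
    simp only [waterFilling, PMF.support_pure, Set.mem_singleton_iff] at hs
    subst hs
    simp
  | succ l ih =>
    rw [waterFilling, PMF.mem_support_bind_iff] at hs
    obtain ⟨s', hs', hs⟩ := hs
    obtain ⟨h1, h2, h3⟩ := ih (by omega) hs'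
    have hne : (Finset.univ.filter fun i => s' i < a i).Nonempty := by
      by_contra hcon
      rw [Finset.not_nonempty_iff_eq_empty, Finset.filter_eq_empty_iff] at hcon
      have : ∑ i, a i ≤ ∑ i, s' i := Finset.sum_le_sum fun i hi => not_lt.1 (hcon hi)
      omega
    have := mem_of_mem_support_uniformOr ((argminOn_nonempty hne _).image _) hs
    rw [Finset.mem_image] at this
    obtain ⟨e, he, rfl⟩ := this
    rw [mem_argminOn] at he
    simp only [Finset.mem_filter, Finset.mem_univ, true_and] at he
    have hle : ∀ j, s' j ≤ (s' + Pi.single e 1 : Fin m → ℕ) j := fun j => by simp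
    refine ⟨fun i => ?_, ?_, ?_⟩
    · by_cases hi : i = e
      · subst hi; simpa using he.1
      · simpa [hi] using h1 i
    · simp [Finset.sum_add_distrib, h2]
    · intro i j hi hj
      have hj' : s' j < a j := (hle j).trans_lt hj
      have hjle : w j + c * (s' j : ℝ) ≤ w j + c * ((s' + Pi.single e 1 : Fin m → ℕ) j : ℕ) := by
        have : (s' j : ℝ) ≤ ((s' + Pi.single e 1 : Fin m → ℕ) j : ℕ) := by exact_mod_cast hle j
        nlinarith
      refine le_trans ?_ hjle
      by_cases hie : i = e
      · subst hie
        simpa using he.2 j hj'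
      · have : (s' + Pi.single e 1 : Fin m → ℕ) i = s' i := by simp [hie]
        rw [this] at hi ⊢
        exact h3 i j hi hj'

theorem levelVector_le {k : ℕ} {a : Fin m → ℕ} (h : ∀ i, k / m ≤ a i) {T : Finset (Fin m)}
    (hT : T ⊆ extraServers k a) (i : Fin m) : levelVector (k / m) T i ≤ a i := by
  unfold levelVector
  split
  · next hi => simpa [extraServers] using hT hi
  · exact h i

/-- Batch sampling and water-filling are greedy relative to balanced random. -/
theorem routing_greedy (hm : 0 < m) {c : ℝ} (hc : 0 < c) {pol : Policy} (hpol : pol ≠ .BR)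
    {b k : ℕ} (hk : k ≤ b)
    {a : Fin m → ℕ} (ha : a ∈ (placementLaw m b).support) {w : Fin m → ℝ} {s r : Fin m → ℕ}
    (hs : s ∈ (pol.routing c w k a).support) (hr : r ∈ (balancedRandom k a).support) :
    Greedy c w s r ∧ ∑ i, s i = ∑ i, r i := by
  obtain ⟨h1, h2, h3⟩ := placementLaw_support_facts hm hk ha
  obtain ⟨R, hRA, hR, rfl⟩ := balancedRandom_support h2 hr
  have hsum : ∑ i, levelVector (k / m) R i = k := by
    rw [sum_levelVector, hR, Nat.div_add_mod]
  cases pol with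
  | BR => exact absurd rfl hpol
  | BS =>
    simp only [Policy.routing, batchSampling, PMF.mem_support_map_iff] at hs
    obtain ⟨T, hT, rfl⟩ := hs
    obtain ⟨hTA, hTc, hTw⟩ := leastLoaded_support h2 hT
    refine ⟨fun i j hi hj => ?_, by rw [hsum, sum_levelVector, hTc, Nat.div_add_mod]⟩
    have hiT : i ∈ T ∧ i ∉ R := by
      unfold levelVector at hi
      by_cases h1 : i ∈ T <;> by_cases h2 : i ∈ R <;> simp_all
    have hjT : j ∈ R ∧ j ∉ T := by
      unfold levelVector at hj
      by_cases h1 : j ∈ T <;> by_cases h2 : j ∈ R <;> simp_all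
    have := hTw i hiT.1 j (Finset.mem_sdiff.2 ⟨hRA hjT.1, hjT.2⟩)
    simp only [levelVector, hiT.1, hjT.2, if_true, if_false]
    push_cast
    linarith
  | WF =>
    obtain ⟨g1, g2, g3⟩ := waterFilling_support hc h3 hs
    refine ⟨fun i j hi hj => g3 i j (Nat.zero_lt_of_lt hi) ?_, by rw [g2, hsum]⟩
    exact hj.trans_le (levelVector_le h1 hRA j)

/-! ### Measurability of the routing probabilities -/

theorem measurable_comp_argminOn {Ω : Type*} [MeasurableSpace Ω] (A : Finset (Fin m))
    {u : Ω → Fin m → ℝ} (hu : Measurable u) (f : Finset (Fin m) → ℝ≥0∞) :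
    Measurable fun ω => f (argminOn A (u ω)) := by
  let _ : MeasurableSpace (Finset (Fin m)) := ⊤
  have hf : Measurable f := measurable_from_top
  refine hf.comp (measurable_to_countable' fun F => ?_)
  have e : (fun ω => argminOn A (u ω)) ⁻¹' {F} =
      ⋂ i, {ω | i ∈ F ↔ (i ∈ A ∧ ∀ j ∈ A, u ω i ≤ u ω j)} := by
    ext ω
    simp only [Set.mem_preimage, Set.mem_singleton_iff, Set.mem_iInter, Set.mem_ofPred_eq,
      Finset.ext_iff, mem_argminOn]
    exact forall_congr' fun i => Iff.comm
  rw [e]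
  have hui : ∀ i, Measurable fun ω => u ω i := fun i => (measurable_pi_apply i).comp hu
  refine MeasurableSet.iInter fun i => ?_
  have h1 : MeasurableSet {ω | i ∈ A ∧ ∀ j ∈ A, u ω i ≤ u ω j} := by
    have : {ω | i ∈ A ∧ ∀ j ∈ A, u ω i ≤ u ω j} =
        {_ω | i ∈ A} ∩ ⋂ j ∈ A, {ω | u ω i ≤ u ω j} := by ext; simp
    rw [this]
    exact (MeasurableSet.const _).inter
      (Finset.measurableSet_biInter A fun j _ => measurableSet_le (hui i) (hui j))
  by_cases hi : i ∈ F
  · simpa only [hi, true_iff] using h1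
  · simp only [hi, false_iff]
    exact h1.compl

theorem measurable_leastLoaded (A : Finset (Fin m)) (l : ℕ) (T : Finset (Fin m)) :
    Measurable fun w : Fin m → ℝ => leastLoaded w A l T := by
  induction l generalizing T with
  | zero => exact measurable_const
  | succ l ih =>
    simp only [leastLoaded, PMF.bind_apply]
    exact Measurable.tsum fun T' => (ih T').mul
      (measurable_comp_argminOn (A \ T') measurable_id
        fun F => uniformOr (F.image fun i => insert i T') T' T)

/-- Law of the routing vector after one more block is requested from a uniformly random server of
`F`, when `s` records the blocks requested so far. -/
noncomputable def waterFillingStep (s : Fin m → ℕ) (F : Finset (Fin m)) : PMF (Fin m → ℕ) :=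
  uniformOr (F.image fun i => s + Pi.single i 1) s

theorem measurable_waterFilling (c : ℝ) (a : Fin m → ℕ) (l : ℕ) (s : Fin m → ℕ) :
    Measurable fun w : Fin m → ℝ => waterFilling c w a l s := by
  induction l generalizing s with
  | zero => exact measurable_const
  | succ l ih =>
    have hu : ∀ s' : Fin m → ℕ,
        Measurable fun (w : Fin m → ℝ) (i : Fin m) => w i + c * (s' i : ℝ) := by
      intro s'; fun_prop
    simp only [waterFilling, PMF.bind_apply]
    refine Measurable.tsum fun s' => (ih s').mul ?_
    exact measurable_comp_argminOn (Finset.univ.filter fun i => s' i < a i) (hu s')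
      fun F => waterFillingStep s' F s
theorem measurable_routing (pol : Policy) (c : ℝ) (k : ℕ) (a r : Fin m → ℕ) :
    Measurable fun w : Fin m → ℝ => pol.routing c w k a r := by
  cases pol with
  | BR => exact measurable_const
  | BS =>
    simp only [Policy.routing, batchSampling, PMF.map_apply]
    refine Measurable.tsum fun T => ?_
    by_cases h : r = levelVector (k / m) T
    · simpa [h] using measurable_leastLoaded _ _ T
    · simp [h]
  | WF => exact measurable_waterFilling c a k r

end

/-! ### The conditional law of one step -/

section

section history

variable {Ω : Type*} {m : ℕ} {κ : ℕ → Ω → ℕ} {a s : ℕ → Ω → Fin m → ℕ} {τ : ℕ → Ω → ℝ}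

theorem history_mono {n n' : ℕ} (h : n ≤ n') : history κ a s τ n ≤ history κ a s τ n' :=
  iSup_mono fun _ => iSup_mono' fun hj => ⟨hj.trans_le h, le_rfl⟩

theorem measurable_history {n j : ℕ} (hj : j < n) :
    Measurable[history κ a s τ n] fun ω => (κ j ω, a j ω, s j ω, τ j ω) := by
  rw [measurable_iff_comap_le]
  exact le_iSup₂_of_le j hj le_rfl

end history

variable {Ω : Type*} [MeasurableSpace Ω] {P : Measure Ω} {p : Params} {pol : Policy}
  {κ : ℕ → Ω → ℕ} {a s : ℕ → Ω → Fin p.m → ℕ} {τ : ℕ → Ω → ℝ} {W : ℕ → Ω → Fin p.m → ℝ}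

instance (p : Params) : IsProbabilityMeasure (expMeasure (p.lam * p.m)) :=
  isProbabilityMeasure_expMeasure (mul_pos p.lam_pos (Nat.cast_pos.2 p.m_pos))

namespace IsSystem

theorem history_le (h : IsSystem P p pol κ a s τ W) (n : ℕ) :
    history κ a s τ n ≤ ‹MeasurableSpace Ω› :=
  iSup₂_le fun j _ => measurable_iff_comap_le.1 ((h.measurable_κ j).prodMk
    ((h.measurable_a j).prodMk ((h.measurable_s j).prodMk (h.measurable_τ j))))

theorem measurable_W_history (h : IsSystem P p pol κ a s τ W) (n : ℕ) :
    Measurable[history κ a s τ n] (W n) := by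
  induction n with
  | zero =>
    have : W 0 = fun _ => 0 := funext h.W_zero
    rw [this]
    exact measurable_const
  | succ n ih =>
    have hW : Measurable[history κ a s τ (n + 1)] (W n) :=
      ih.mono (history_mono n.le_succ) le_rfl
    have hz := measurable_history (κ := κ) (a := a) (s := s) (τ := τ) n.lt_succ_self
    have hs : Measurable[history κ a s τ (n + 1)] (s n) := hz.snd.snd.fst
    have ht : Measurable[history κ a s τ (n + 1)] (τ n) := hz.snd.snd.snd
    have hsucc := h.W_succ n
    let _ : MeasurableSpace Ω := history κ a s τ (n + 1)
    refine measurable_pi_lambda _ fun i => ?_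
    simp only [hsucc]
    have hsi : Measurable fun ω => (s n ω i : ℝ) :=
      measurable_from_top.comp ((measurable_pi_apply i).comp hs)
    have hWi : Measurable fun ω => W n ω i := (measurable_pi_apply i).comp hW
    exact ((hWi.add (hsi.const_mul _)).sub (ht.const_mul _)).max measurable_const

theorem measurable_W (h : IsSystem P p pol κ a s τ W) (n : ℕ) : Measurable (W n) :=
  (h.measurable_W_history n).mono (h.history_le n) le_rfl

/-- On the event that the `n`-th request has size `k`, placement `x` and routing vector `r`, the
workload and the inter-arrival time are independent, and the workload has a density given by the
routing probabilities. -/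
theorem map_restrict_eq [IsProbabilityMeasure P] (h : IsSystem P p pol κ a s τ W) (n k : ℕ)
    (x r : Fin p.m → ℕ) :
    (P.restrict {ω | κ n ω = k ∧ a n ω = x ∧ s n ω = r}).map (fun ω => (W n ω, τ n ω)) =
      ((P.withDensity fun ω =>
        p.π k * placementLaw p.m (p.α k) x * pol.routing p.c (W n ω) k x r).map (W n)).prod
        (expMeasure (p.lam * p.m)) := by
  have hfin : IsFiniteMeasure (P.withDensity fun ω =>
      p.π k * placementLaw p.m (p.α k) x * pol.routing p.c (W n ω) k x r) := by
    refine isFiniteMeasure_withDensity (ne_top_of_le_ne_top (b := 1) ENNReal.one_ne_top ?_)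
    refine (lintegral_mono (g := fun _ => 1) fun ω => ?_).trans (by simp)
    exact mul_le_one' (mul_le_one' (PMF.coe_le_one _ _) (PMF.coe_le_one _ _))
      (PMF.coe_le_one _ _)
  symm
  refine Measure.prod_eq fun C B hC hB => ?_
  have hWC : MeasurableSet (W n ⁻¹' C) := h.measurable_W n hC
  rw [Measure.map_apply ((h.measurable_W n).prodMk (h.measurable_τ n)) (hC.prod hB),
    Measure.restrict_apply (((h.measurable_W n).prodMk (h.measurable_τ n)) (hC.prod hB)),
    Measure.map_apply (h.measurable_W n) hC, withDensity_apply _ hWC,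
    ← h.step n _ (h.measurable_W_history n hC) k x r B hB]
  congr 1
  ext ω
  simp only [Set.mem_inter_iff, Set.mem_preimage, Set.mem_prod, Set.mem_ofPred_eq]
  tauto

/-- Mean of a function of one step, conditionally on the history. -/
theorem lintegral_step [IsProbabilityMeasure P] (h : IsSystem P p pol κ a s τ W) (n : ℕ)
    {F : ℕ → (Fin p.m → ℝ) → (Fin p.m → ℕ) → ℝ → ℝ≥0∞}
    (hF : ∀ k r, Measurable fun z : (Fin p.m → ℝ) × ℝ => F k z.1 r z.2) :
    ∫⁻ ω, F (κ n ω) (W n ω) (s n ω) (τ n ω) ∂P =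
      ∫⁻ ω, ∑' k, ∑' x, ∑' r,
        p.π k * placementLaw p.m (p.α k) x * pol.routing p.c (W n ω) k x r *
          ∫⁻ t, F k (W n ω) r t ∂expMeasure (p.lam * p.m) ∂P := by
  set E : ℕ × (Fin p.m → ℕ) × (Fin p.m → ℕ) → Set Ω :=
    fun z => {ω | κ n ω = z.1 ∧ a n ω = z.2.1 ∧ s n ω = z.2.2}
  have hEm : ∀ z, MeasurableSet (E z) := fun z =>
    (h.measurable_κ n (measurableSet_singleton z.1)).inter
      ((h.measurable_a n (measurableSet_singleton z.2.1)).inter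
        (h.measurable_s n (measurableSet_singleton z.2.2)))
  have hEd : Pairwise (Function.onFun Disjoint E) := by
    intro z z' hz
    refine Set.disjoint_left.2 fun ω h1 h2 => hz ?_
    exact Prod.ext (h1.1.symm.trans h2.1)
      (Prod.ext (h1.2.1.symm.trans h2.2.1) (h1.2.2.symm.trans h2.2.2))
  have hEu : ⋃ z, E z = Set.univ :=
    Set.eq_univ_of_forall fun ω => Set.mem_iUnion.2 ⟨(κ n ω, a n ω, s n ω), rfl, rfl, rfl⟩
  have hdens : ∀ k x r, Measurable fun ω =>
      p.π k * placementLaw p.m (p.α k) x * pol.routing p.c (W n ω) k x r := fun k x r =>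
    ((measurable_routing pol p.c k x r).comp (h.measurable_W n)).const_mul _
  have hint : ∀ k r, Measurable fun w =>
      ∫⁻ t, F k w r t ∂expMeasure (p.lam * p.m) := fun k r =>
    (hF k r).lintegral_prod_right'
  have hintW : ∀ k r, Measurable fun ω =>
      ∫⁻ t, F k (W n ω) r t ∂expMeasure (p.lam * p.m) := fun k r =>
    (hint k r).comp (h.measurable_W n)
  have hterm : ∀ z : ℕ × (Fin p.m → ℕ) × (Fin p.m → ℕ), Measurable fun ω =>
      p.π z.1 * placementLaw p.m (p.α z.1) z.2.1 * pol.routing p.c (W n ω) z.1 z.2.1 z.2.2 *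
        ∫⁻ t, F z.1 (W n ω) z.2.2 t ∂expMeasure (p.lam * p.m) := fun z =>
    (hdens z.1 z.2.1 z.2.2).mul (hintW z.1 z.2.2)
  rw [← setLIntegral_univ, ← hEu, lintegral_iUnion hEm hEd]
  have key : ∀ z, ∫⁻ ω in E z, F (κ n ω) (W n ω) (s n ω) (τ n ω) ∂P =
      ∫⁻ ω, p.π z.1 * placementLaw p.m (p.α z.1) z.2.1 *
        pol.routing p.c (W n ω) z.1 z.2.1 z.2.2 *
          ∫⁻ t, F z.1 (W n ω) z.2.2 t ∂expMeasure (p.lam * p.m) ∂P := by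
    rintro ⟨k, x, r⟩
    have e1 : ∫⁻ ω in E (k, x, r), F (κ n ω) (W n ω) (s n ω) (τ n ω) ∂P =
        ∫⁻ ω in E (k, x, r), F k (W n ω) r (τ n ω) ∂P :=
      setLIntegral_congr_fun (hEm _) fun ω hω => by
        obtain ⟨h1, -, h3⟩ := hω
        simp only at h1 h3
        simp only [h1, h3]
    rw [e1, ← lintegral_map (f := fun z : (Fin p.m → ℝ) × ℝ => F k z.1 r z.2) (hF k r)
      ((h.measurable_W n).prodMk (h.measurable_τ n)), h.map_restrict_eq n k x r,
      lintegral_prod _ (hF k r).aemeasurable, lintegral_map (hint k r) (h.measurable_W n),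
      lintegral_withDensity_eq_lintegral_mul _ (hdens k x r) (hintW k r)]
    rfl
  simp_rw [key]
  rw [← lintegral_tsum fun z => (hterm z).aemeasurable]
  refine lintegral_congr fun ω => ?_
  rw [ENNReal.tsum_prod']
  refine tsum_congr fun k => ?_
  rw [ENNReal.tsum_prod']

end IsSystem

/-- If every value of `G` on the support of `q` dominates every value on the support of `q'`, so do
the means. -/
theorem tsum_pmf_mul_le {β : Type*} (q q' : PMF β) (G : β → ℝ≥0∞)
    (h : ∀ s ∈ q.support, ∀ r ∈ q'.support, G s ≤ G r) :
    ∑' s, q s * G s ≤ ∑' r, q' r * G r := by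
  have e1 : ∑' s, q s * G s = ∑' s, ∑' r, q s * q' r * G s := by
    refine tsum_congr fun s => ?_
    rw [ENNReal.tsum_mul_right, ENNReal.tsum_mul_left, PMF.tsum_coe, mul_one]
  have e2 : ∑' r, q' r * G r = ∑' s, ∑' r, q s * q' r * G r := by
    rw [ENNReal.tsum_comm]
    refine tsum_congr fun r => ?_
    rw [ENNReal.tsum_mul_right, ENNReal.tsum_mul_right, PMF.tsum_coe, one_mul]
  rw [e1, e2]
  refine ENNReal.tsum_le_tsum fun s => ENNReal.tsum_le_tsum fun r => ?_
  by_cases hs : q s = 0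
  · simp [hs]
  by_cases hr : q' r = 0
  · simp [hr]
  gcongr
  exact h s ((PMF.mem_support_iff _ _).2 hs) r ((PMF.mem_support_iff _ _).2 hr)

theorem tsum_bind_mul {β γ : Type*} (q : PMF β) (f : β → PMF γ) (G : γ → ℝ≥0∞) :
    ∑' r, q.bind f r * G r = ∑' b, q b * ∑' r, f b r * G r := by
  simp_rw [PMF.bind_apply, ← ENNReal.tsum_mul_right, ← ENNReal.tsum_mul_left]
  rw [ENNReal.tsum_comm]
  simp_rw [mul_assoc]

theorem tsum_placement_balancedRandom {m : ℕ} (α : ℕ → ℕ) (k : ℕ) (b : ℝ≥0∞)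
    (G : (Fin m → ℕ) → ℝ≥0∞) :
    ∑' x, ∑' r, b * placementLaw m (α k) x * balancedRandom k x r * G r =
      b * ∑' r, typicalBR m α k r * G r := by
  rw [typicalBR, tsum_bind_mul]
  simp_rw [← ENNReal.tsum_mul_left, mul_assoc]

namespace IsSystem

theorem lintegral_step_BR [IsProbabilityMeasure P] (h : IsSystem P p .BR κ a s τ W) (n : ℕ)
    {F : ℕ → (Fin p.m → ℝ) → (Fin p.m → ℕ) → ℝ → ℝ≥0∞}
    (hF : ∀ k r, Measurable fun z : (Fin p.m → ℝ) × ℝ => F k z.1 r z.2) :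
    ∫⁻ ω, F (κ n ω) (W n ω) (s n ω) (τ n ω) ∂P =
      ∫⁻ ω, ∑' k, p.π k * ∑' r, typicalBR p.m p.α k r *
          ∫⁻ t, F k (W n ω) r t ∂expMeasure (p.lam * p.m) ∂P := by
  rw [h.lintegral_step n hF]
  simp only [Policy.routing, tsum_placement_balancedRandom]

/-- One step under any of the policies is dominated by a balanced random step from the same
workload, for costs that increase when blocks are moved to higher levels. -/
theorem lintegral_step_le [IsProbabilityMeasure P] (h : IsSystem P p pol κ a s τ W) (n : ℕ)
    {F : ℕ → (Fin p.m → ℝ) → (Fin p.m → ℕ) → ℝ → ℝ≥0∞}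
    (hF : ∀ k r, Measurable fun z : (Fin p.m → ℝ) × ℝ => F k z.1 r z.2)
    (hG : ∀ k w s r t, Greedy p.c w s r → ∑ i, s i = ∑ i, r i → F k w s t ≤ F k w r t) :
    ∫⁻ ω, F (κ n ω) (W n ω) (s n ω) (τ n ω) ∂P ≤
      ∫⁻ ω, ∑' k, p.π k * ∑' r, typicalBR p.m p.α k r *
          ∫⁻ t, F k (W n ω) r t ∂expMeasure (p.lam * p.m) ∂P := by
  by_cases hpol : pol = .BR
  · subst hpol
    exact (h.lintegral_step_BR n hF).le
  rw [h.lintegral_step n hF]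
  refine lintegral_mono fun ω => ENNReal.tsum_le_tsum fun k => ?_
  rw [← tsum_placement_balancedRandom]
  refine ENNReal.tsum_le_tsum fun x => ?_
  by_cases hx : x ∈ (placementLaw p.m (p.α k)).support
  · simp_rw [mul_assoc, ENNReal.tsum_mul_left]
    refine mul_le_mul' le_rfl (mul_le_mul' le_rfl ?_)
    refine tsum_pmf_mul_le _ _ _ fun s hs r hr => ?_
    obtain ⟨h1, h2⟩ := routing_greedy p.m_pos p.c_pos hpol (p.le_α k) hx hs hr
    exact lintegral_mono fun t => hG k _ s r t h1 h2
  · rw [PMF.mem_support_iff, not_not] at hx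
    simp [hx]

end IsSystem

end

/-! ### The balanced random workload as a Markov chain -/

section

theorem lintegral_toMeasure {β : Type*} [MeasurableSpace β] [Countable β]
    [MeasurableSingletonClass β] (q : PMF β) (G : β → ℝ≥0∞) :
    ∫⁻ r, G r ∂q.toMeasure = ∑' r, q r * G r := by
  rw [lintegral_countable']
  refine tsum_congr fun r => ?_
  rw [PMF.toMeasure_apply_singleton _ _ (measurableSet_singleton r), mul_comm]

/-- Workload seen by the next arrival, after a request routed by `r` and an inter-arrival time
`t`. -/
def nextWorkload (p : Params) (w : Fin p.m → ℝ) (r : Fin p.m → ℕ) (t : ℝ) : Fin p.m → ℝ :=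
  fun i => max (w i + p.c * (r i : ℝ) - p.μ * t) 0

variable {p : Params}

theorem measurable_nextWorkload : Measurable
    fun z : (Fin p.m → ℝ) × (Fin p.m → ℕ) × ℝ => nextWorkload p z.1 z.2.1 z.2.2 := by
  refine measurable_pi_lambda _ fun i => ?_
  have h1 : Measurable fun z : (Fin p.m → ℝ) × (Fin p.m → ℕ) × ℝ => z.1 i :=
    (measurable_pi_apply i).comp measurable_fst
  have h2 : Measurable fun z : (Fin p.m → ℝ) × (Fin p.m → ℕ) × ℝ => (z.2.1 i : ℝ) :=
    measurable_from_top.comp ((measurable_pi_apply i).comp measurable_snd.fst)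
  have h3 : Measurable fun z : (Fin p.m → ℝ) × (Fin p.m → ℕ) × ℝ => z.2.2 := measurable_snd.snd
  exact ((h1.add (h2.const_mul _)).sub (h3.const_mul _)).max measurable_const

theorem measurable_nextWorkload_pair (r : Fin p.m → ℕ) :
    Measurable fun z : (Fin p.m → ℝ) × ℝ => nextWorkload p z.1 r z.2 :=
  measurable_nextWorkload.comp
    (f := fun z : (Fin p.m → ℝ) × ℝ => (z.1, r, z.2)) (by fun_prop)

/-- Law of the balanced random routing vector. -/
noncomputable def brLaw (p : Params) : PMF (Fin p.m → ℕ) := p.π.bind (typicalBR p.m p.α)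

/-- Law of the workload vector seen by the `n`-th arrival under balanced random. -/
noncomputable def brWorkloadLaw (p : Params) : ℕ → Measure (Fin p.m → ℝ)
  | 0 => Measure.dirac 0
  | n + 1 => ((brWorkloadLaw p n).prod
      ((brLaw p).toMeasure.prod (expMeasure (p.lam * p.m)))).map
        fun z => nextWorkload p z.1 z.2.1 z.2.2

instance (p : Params) (n : ℕ) : IsProbabilityMeasure (brWorkloadLaw p n) := by
  induction n with
  | zero => unfold brWorkloadLaw; infer_instance
  | succ n ih =>
    unfold brWorkloadLaw
    exact Measure.isProbabilityMeasure_map measurable_nextWorkload.aemeasurable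

/-- Mean of `φ` at the workload seen by the next arrival under balanced random. -/
noncomputable def brStep (p : Params) (φ : (Fin p.m → ℝ) → ℝ≥0∞) (w : Fin p.m → ℝ) : ℝ≥0∞ :=
  ∑' r, brLaw p r * ∫⁻ t, φ (nextWorkload p w r t) ∂expMeasure (p.lam * p.m)

theorem measurable_brStep {φ : (Fin p.m → ℝ) → ℝ≥0∞} (hφ : Measurable φ) :
    Measurable (brStep p φ) := by
  refine Measurable.tsum fun r => Measurable.const_mul ?_ _
  exact (hφ.comp (measurable_nextWorkload_pair r)).lintegral_prod_right'

theorem lintegral_brWorkloadLaw_succ (n : ℕ) {φ : (Fin p.m → ℝ) → ℝ≥0∞} (hφ : Measurable φ) :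
    ∫⁻ w, φ w ∂brWorkloadLaw p (n + 1) = ∫⁻ w, brStep p φ w ∂brWorkloadLaw p n := by
  have hm : Measurable fun z : (Fin p.m → ℝ) × (Fin p.m → ℕ) × ℝ =>
      φ (nextWorkload p z.1 z.2.1 z.2.2) := hφ.comp measurable_nextWorkload
  rw [brWorkloadLaw, lintegral_map hφ measurable_nextWorkload,
    lintegral_prod _ hm.aemeasurable]
  refine lintegral_congr fun w => ?_
  have hmw : Measurable fun z : (Fin p.m → ℕ) × ℝ => φ (nextWorkload p w z.1 z.2) :=
    hm.comp measurable_prodMk_left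
  rw [lintegral_prod _ hmw.aemeasurable, lintegral_toMeasure]
  rfl

theorem tsum_size_eq_brStep (φ : (Fin p.m → ℝ) → ℝ≥0∞) (w : Fin p.m → ℝ) :
    ∑' k, p.π k * ∑' r, typicalBR p.m p.α k r *
      ∫⁻ t, φ (nextWorkload p w r t) ∂expMeasure (p.lam * p.m) = brStep p φ w :=
  (tsum_bind_mul _ _ _).symm

section systems

variable {Ω : Type*} [MeasurableSpace Ω] {P : Measure Ω} {pol : Policy}
  {κ : ℕ → Ω → ℕ} {a s : ℕ → Ω → Fin p.m → ℕ} {τ : ℕ → Ω → ℝ} {W : ℕ → Ω → Fin p.m → ℝ}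

theorem IsSystem.W_succ_eq (h : IsSystem P p pol κ a s τ W) (n : ℕ) (ω : Ω) :
    W (n + 1) ω = nextWorkload p (W n ω) (s n ω) (τ n ω) :=
  funext fun i => h.W_succ n ω i

theorem IsSystem.map_W_eq [IsProbabilityMeasure P] (h : IsSystem P p .BR κ a s τ W) (n : ℕ) :
    P.map (W n) = brWorkloadLaw p n := by
  induction n with
  | zero =>
    have : W 0 = fun _ => 0 := funext h.W_zero
    rw [this, Measure.map_const, measure_univ, one_smul, brWorkloadLaw]
  | succ n ih =>
    refine Measure.ext_of_lintegral _ fun φ hφ => ?_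
    rw [lintegral_map hφ (h.measurable_W _), lintegral_brWorkloadLaw_succ n hφ, ← ih,
      lintegral_map (measurable_brStep hφ) (h.measurable_W n)]
    simp_rw [h.W_succ_eq n]
    rw [h.lintegral_step_BR n (F := fun _ w r t => φ (nextWorkload p w r t))
      fun _ r => hφ.comp (measurable_nextWorkload_pair r)]
    simp_rw [tsum_size_eq_brStep]

end systems

/-! ### Association of the balanced random workload -/

theorem posAssoc_brWorkloadLaw (hπ : p.π ∈ Theta p.m p.α) (n : ℕ) :
    PosAssoc (brWorkloadLaw p n) := by
  have hcast : Measurable fun (r : Fin p.m → ℕ) (i : Fin p.m) => (r i : ℝ) :=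
    measurable_pi_lambda _ fun i => measurable_from_top.comp (measurable_pi_apply i)
  induction n with
  | zero => exact posAssoc_dirac 0
  | succ n ih =>
    -- the next workload increases with the workload, the routing vector and minus the time
    have hR : PosAssoc ((brLaw p).toMeasure.map fun (r : Fin p.m → ℕ) i => (r i : ℝ)) :=
      Associated.posAssoc hπ hcast
    have : IsProbabilityMeasure ((brLaw p).toMeasure.map
        fun (r : Fin p.m → ℕ) i => (r i : ℝ)) :=
      Measure.isProbabilityMeasure_map hcast.aemeasurable
    have : IsProbabilityMeasure ((expMeasure (p.lam * p.m)).map fun t : ℝ => -t) :=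
      Measure.isProbabilityMeasure_map measurable_neg.aemeasurable
    have hT : PosAssoc ((expMeasure (p.lam * p.m)).map fun t : ℝ => -t) :=
      posAssoc_of_linearOrder _
    have hψ : Measurable fun (z : (Fin p.m → ℝ) × (Fin p.m → ℝ) × ℝ) (i : Fin p.m) =>
        max (z.1 i + p.c * z.2.1 i + p.μ * z.2.2) 0 := by
      fun_prop
    have h := (ih.prod (hR.prod hT)).map
      (φ := fun z i => max (z.1 i + p.c * z.2.1 i + p.μ * z.2.2) 0) ?_ hψ
    · rw [← Measure.map_id (μ := brWorkloadLaw p n), Measure.map_prod_map _ _ hcast measurable_neg,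
        Measure.map_prod_map _ _ measurable_id (hcast.prodMap measurable_neg),
        Measure.map_map hψ (measurable_id.prodMap (hcast.prodMap measurable_neg))] at h
      rw [brWorkloadLaw]
      convert h using 2
      funext z i
      simp [nextWorkload, sub_eq_add_neg]
    · intro z z' hz i
      have h1 := hz.1 i
      have h2 := mul_le_mul_of_nonneg_left (hz.2.1 i) p.c_pos.le
      have h3 := mul_le_mul_of_nonneg_left hz.2.2 p.μ_pos.le
      exact max_le_max (add_le_add (add_le_add h1 h2) h3) le_rfl

/-! ### Balanced random is the worst policy -/

/-- Means over an exchangeable random vector of jointly symmetric, increasing, convex functions. -/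
theorem SymConvex.of_tsum {m : ℕ} {q : (Fin m → ℕ) → ℝ≥0∞}
    (hq : ∀ (σ : Equiv.Perm (Fin m)) r, q (r ∘ σ) = q r)
    {G : (Fin m → ℝ) → (Fin m → ℕ) → ℝ≥0∞} (hmono : ∀ r, Monotone fun w => G w r)
    (hsymm : ∀ (σ : Equiv.Perm (Fin m)) w r, G (w ∘ σ) (r ∘ σ) = G w r)
    (hconv : ∀ r x y (a b : ℝ), 0 ≤ a → 0 ≤ b → a + b = 1 →
      G (a • x + b • y) r ≤ ENNReal.ofReal a * G x r + ENNReal.ofReal b * G y r)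
    (hmeas : ∀ r, Measurable fun w => G w r) :
    SymConvex fun w => ∑' r, q r * G w r where
  mono x y hxy := ENNReal.tsum_le_tsum fun r => mul_le_mul_right (hmono r hxy) _
  symm σ x := by
    rw [← (Equiv.arrowCongr σ.symm (Equiv.refl ℕ)).tsum_eq]
    refine tsum_congr fun r => ?_
    have e : Equiv.arrowCongr σ.symm (Equiv.refl ℕ) r = r ∘ σ := rfl
    rw [e, hq, hsymm]
  convex x y a b ha hb hab := by
    rw [← ENNReal.tsum_mul_left, ← ENNReal.tsum_mul_left, ← ENNReal.tsum_add]
    refine ENNReal.tsum_le_tsum fun r =>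
      (mul_le_mul_right (hconv r x y a b ha hb hab) _).trans_eq ?_
    ring
  measurable := Measurable.tsum fun r => (hmeas r).const_mul _

theorem max_convex_comb_le {a b : ℝ} (ha : 0 ≤ a) (hb : 0 ≤ b) (hab : a + b = 1) (x y d : ℝ) :
    max (a * x + b * y + d) 0 ≤ a * max (x + d) 0 + b * max (y + d) 0 := by
  have h1 := mul_le_mul_of_nonneg_left (le_max_left (x + d) 0) ha
  have h2 := mul_le_mul_of_nonneg_left (le_max_left (y + d) 0) hb
  have h3 := mul_nonneg ha (le_max_right (x + d) 0)
  have h4 := mul_nonneg hb (le_max_right (y + d) 0)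
  refine max_le ?_ (by linarith)
  have : a * x + b * y + d = a * (x + d) + b * (y + d) := by
    linear_combination (-d) * hab
  linarith

theorem nextWorkload_mono (r : Fin p.m → ℕ) (t : ℝ) :
    Monotone fun w => nextWorkload p w r t := fun x y hxy i =>
  max_le_max (by have := hxy i; linarith) le_rfl

theorem nextWorkload_convex (r : Fin p.m → ℕ) (t : ℝ) {a b : ℝ} (ha : 0 ≤ a) (hb : 0 ≤ b)
    (hab : a + b = 1) (x y : Fin p.m → ℝ) :
    nextWorkload p (a • x + b • y) r t ≤ a • nextWorkload p x r t + b • nextWorkload p y r t := by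
  intro i
  have := max_convex_comb_le ha hb hab (x i) (y i) (p.c * r i - p.μ * t)
  simpa [nextWorkload, add_sub_assoc] using this

/-- A balanced random step preserves the cone of symmetric convex increasing functions. -/
theorem SymConvex.brStep {φ : (Fin p.m → ℝ) → ℝ≥0∞} (hφ : SymConvex φ) :
    SymConvex (brStep p φ) := by
  have hmt : ∀ w r, Measurable fun t => φ (nextWorkload p w r t) := fun w r =>
    (hφ.measurable.comp (measurable_nextWorkload_pair r)).comp measurable_prodMk_left
  refine SymConvex.of_tsum ?_ ?_ ?_ ?_ ?_
  · intro σ r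
    simp only [brLaw, PMF.bind_apply, typicalBR_comp_apply]
  · exact fun r x y hxy => lintegral_mono fun t => hφ.mono (nextWorkload_mono r t hxy)
  · intro σ w r
    refine lintegral_congr fun t => ?_
    exact hφ.symm σ (nextWorkload p w r t)
  · intro r x y a b ha hb hab
    rw [← lintegral_const_mul _ (hmt x r), ← lintegral_const_mul _ (hmt y r),
      ← lintegral_add_left ((hmt x r).const_mul _)]
    exact lintegral_mono fun t =>
      (hφ.mono (nextWorkload_convex r t ha hb hab x y)).trans (hφ.convex _ _ a b ha hb hab)
  · exact fun r => (hφ.measurable.comp (measurable_nextWorkload_pair r)).lintegral_prod_right'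

/-- Symmetric convex increasing functions of the positive part of the shifted vector, as it occurs
in the workload left after some time, are again of this kind. -/
theorem SymConvex.comp_drain {m : ℕ} {φ : (Fin m → ℝ) → ℝ≥0∞} (hφ : SymConvex φ) (d : ℝ) :
    SymConvex fun y => φ fun i => max (y i + d) 0 where
  mono x y hxy := hφ.mono fun i => max_le_max (by have := hxy i; linarith) le_rfl
  symm σ x := hφ.symm σ fun i => max (x i + d) 0
  convex x y a b ha hb hab := by
    refine (hφ.mono fun i => ?_).trans (hφ.convex _ _ a b ha hb hab)
    simpa using max_convex_comb_le ha hb hab (x i) (y i) d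
  measurable := hφ.measurable.comp (by fun_prop)

theorem Greedy.nextWorkload_le {φ : (Fin p.m → ℝ) → ℝ≥0∞} (hφ : SymConvex φ) {w : Fin p.m → ℝ}
    {s r : Fin p.m → ℕ} (h : Greedy p.c w s r) (hsum : ∑ i, s i = ∑ i, r i) (t : ℝ) :
    φ (nextWorkload p w s t) ≤ φ (nextWorkload p w r t) := by
  have := h.symConvex_le p.c_pos (hφ.comp_drain (-(p.μ * t))) hsum
  simp only [← sub_eq_add_neg] at this
  exact this

/-- Under every policy the workload is dominated, for symmetric convex increasing functions, by the
balanced random workload. -/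
theorem IsSystem.lintegral_W_le {Ω : Type*} [MeasurableSpace Ω] {P : Measure Ω} {pol : Policy}
    {κ : ℕ → Ω → ℕ} {a s : ℕ → Ω → Fin p.m → ℕ} {τ : ℕ → Ω → ℝ} {W : ℕ → Ω → Fin p.m → ℝ}
    [IsProbabilityMeasure P] (h : IsSystem P p pol κ a s τ W) (n : ℕ)
    {φ : (Fin p.m → ℝ) → ℝ≥0∞} (hφ : SymConvex φ) :
    ∫⁻ ω, φ (W n ω) ∂P ≤ ∫⁻ w, φ w ∂brWorkloadLaw p n := by
  induction n generalizing φ with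
  | zero => simp [h.W_zero, brWorkloadLaw, lintegral_dirac' _ hφ.measurable]
  | succ n ih =>
    rw [lintegral_brWorkloadLaw_succ n hφ.measurable]
    refine le_trans ?_ (ih hφ.brStep)
    simp_rw [h.W_succ_eq n]
    refine (h.lintegral_step_le n (F := fun _ w r t => φ (nextWorkload p w r t))
      (fun _ r => hφ.measurable.comp (measurable_nextWorkload_pair r))
      fun _ w s r t hG hs => hG.nextWorkload_le hφ hs t).trans_eq ?_
    simp_rw [tsum_size_eq_brStep]

end

/-! ### The Cavity Queue -/

section

variable {p : Params}

theorem tsum_map_mul {β γ : Type*} (q : PMF β) (f : β → γ) (G : γ → ℝ≥0∞) :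
    ∑' l, q.map f l * G l = ∑' b, q b * G (f b) := by
  classical
  rw [← PMF.bind_pure_comp, tsum_bind_mul]
  refine tsum_congr fun b => ?_
  congr 1
  rw [tsum_eq_single (f b)]
  · simp
  · intro l hl
    simp [hl]

/-- A random variable with atoms of total mass one at the points `u l`. -/
theorem lintegral_comp_of_atoms {Ω : Type*} [MeasurableSpace Ω] {Q : Measure Ω}
    [IsProbabilityMeasure Q] {X : Ω → ℝ} (hX : Measurable X) (q : PMF ℕ) {u : ℕ → ℝ}
    (hu : Function.Injective u) (h : ∀ l, Q {ω | X ω = u l} = q l) (f : ℝ → ℝ≥0∞) :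
    ∫⁻ ω, f (X ω) ∂Q = ∑' l, q l * f (u l) := by
  have hm : ∀ l, MeasurableSet {ω | X ω = u l} := fun l => hX (measurableSet_singleton (u l))
  have hd : Pairwise (Function.onFun Disjoint fun l => {ω | X ω = u l}) := fun l l' hl =>
    Set.disjoint_left.2 fun ω h1 h2 => hl (hu (h1.symm.trans h2))
  have hone : Q (⋃ l, {ω | X ω = u l}) = 1 := by
    rw [measure_iUnion hd hm]
    simp_rw [h]
    exact q.tsum_coe
  have hae : ∀ᵐ ω ∂Q, ω ∈ ⋃ l, {ω | X ω = u l} :=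
    (prob_compl_eq_zero_iff (MeasurableSet.iUnion hm)).2 hone
  rw [← Measure.restrict_eq_self_of_ae_mem hae, lintegral_iUnion hm hd]
  refine tsum_congr fun l => ?_
  rw [setLIntegral_congr_fun (g := fun _ => f (u l)) (hm l) fun ω hω => congrArg f hω,
    setLIntegral_const, h, mul_comm]

/-- Law of the number of blocks requested from server `i`; this is the law of the service
requirements of the Cavity Queue, in chunks. -/
noncomputable def jobLaw (p : Params) (i : Fin p.m) : PMF ℕ := (brLaw p).map fun r => r i

theorem jobLaw_apply (i : Fin p.m) (l : ℕ) :
    jobLaw p i l = ENNReal.ofReal (cavityMass p.m p.π l) := by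
  rw [← toReal_marginal_eq_cavityMass p.m_pos p.π p.le_α i l, ENNReal.ofReal_toReal]
  · rfl
  · exact PMF.apply_ne_top _ _

/-- Mean of `f` at the workload seen by the next arrival, for a single queue with workload `v` and
a job of size `x`. -/
noncomputable def drainMean (p : Params) (f : ℝ → ℝ≥0∞) (v x : ℝ) : ℝ≥0∞ :=
  ∫⁻ t, f (max (v + x - p.μ * t) 0) ∂expMeasure (p.lam * p.m)

theorem measurable_drainMean {f : ℝ → ℝ≥0∞} (hf : Measurable f) :
    Measurable fun z : ℝ × ℝ => drainMean p f z.1 z.2 := by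
  have : Measurable fun z : (ℝ × ℝ) × ℝ => f (max (z.1.1 + z.1.2 - p.μ * z.2) 0) :=
    hf.comp (by fun_prop)
  exact this.lintegral_prod_right'

theorem brStep_comp_eval (f : ℝ → ℝ≥0∞) (i : Fin p.m) (w : Fin p.m → ℝ) :
    brStep p (fun x => f (x i)) w = ∑' l : ℕ, jobLaw p i l * drainMean p f (w i) (p.c * l) := by
  rw [jobLaw, tsum_map_mul]
  rfl

section cavity

variable {Ω : Type*} {mΩ : MeasurableSpace Ω} {Q : Measure Ω} {X τ V : ℕ → Ω → ℝ}

theorem measurable_of_lindley {μ : ℝ} (hX : ∀ n, Measurable (X n)) (hτ : ∀ n, Measurable (τ n))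
    (h0 : ∀ ω, V 0 ω = 0) (hs : ∀ n ω, V (n + 1) ω = max (V n ω + X n ω - μ * τ n ω) 0) (n : ℕ) :
    Measurable (V n) := by
  induction n with
  | zero => rw [funext h0]; exact measurable_const
  | succ n ih =>
    rw [funext (hs n)]
    exact ((ih.add (hX n)).sub ((hτ n).const_mul _)).max measurable_const

/-- The workload seen by the `n`-th arrival depends on the jobs and inter-arrival times before. -/
theorem measurable_lindley_past {μ : ℝ} (h0 : ∀ ω, V 0 ω = 0)
    (hs : ∀ n ω, V (n + 1) ω = max (V n ω + X n ω - μ * τ n ω) 0) (n : ℕ) :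
    Measurable[⨆ j ∈ {j : ℕ ⊕ ℕ | Sum.elim id id j < n},
      MeasurableSpace.comap (Sum.elim X τ j) inferInstance] (V n) := by
  induction n with
  | zero => rw [funext h0]; exact measurable_const
  | succ n ih =>
    have hle : ⨆ j ∈ {j : ℕ ⊕ ℕ | Sum.elim id id j < n},
          MeasurableSpace.comap (Sum.elim X τ j) inferInstance ≤
        ⨆ j ∈ {j : ℕ ⊕ ℕ | Sum.elim id id j < n + 1},
          MeasurableSpace.comap (Sum.elim X τ j) inferInstance :=
      biSup_mono fun j hj => Nat.lt_succ_of_lt hj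
    have hV := ih.mono hle le_rfl
    have hj : ∀ j : ℕ ⊕ ℕ, Sum.elim id id j < n + 1 →
        Measurable[⨆ j ∈ {j : ℕ ⊕ ℕ | Sum.elim id id j < n + 1},
          MeasurableSpace.comap (Sum.elim X τ j) inferInstance] (Sum.elim X τ j) := fun j hj =>
      measurable_iff_comap_le.2 (le_iSup₂_of_le j hj le_rfl)
    have hXn := hj (Sum.inl n) (by simp)
    have hτn := hj (Sum.inr n) (by simp)
    rw [funext (hs n)]
    exact ((hV.add hXn).sub (hτn.const_mul _)).max measurable_const

theorem indepFun_lindley_past {μ : ℝ} (hX : ∀ n, Measurable (X n)) (hτ : ∀ n, Measurable (τ n))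
    (hi : iIndepFun (Sum.elim X τ) Q) (h0 : ∀ ω, V 0 ω = 0)
    (hs : ∀ n ω, V (n + 1) ω = max (V n ω + X n ω - μ * τ n ω) 0) (n : ℕ) :
    IndepFun (V n) (fun ω => (X n ω, τ n ω)) Q := by
  have hle : ∀ j : ℕ ⊕ ℕ, MeasurableSpace.comap (Sum.elim X τ j) inferInstance ≤ mΩ := by
    rintro (j | j)
    · exact (hX j).comap_le
    · exact (hτ j).comap_le
  have hd : Disjoint {j : ℕ ⊕ ℕ | Sum.elim id id j < n} {j | Sum.elim id id j = n} :=
    Set.disjoint_left.2 fun j h1 h2 => h1.ne h2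
  have h := indep_iSup_of_disjoint hle hi hd
  rw [IndepFun_iff_Indep]
  refine indep_of_indep_of_le_left (indep_of_indep_of_le_right h ?_)
    (measurable_iff_comap_le.1 (measurable_lindley_past h0 hs n))
  have hj : ∀ j : ℕ ⊕ ℕ, Sum.elim id id j = n →
      Measurable[⨆ j ∈ {j : ℕ ⊕ ℕ | Sum.elim id id j = n},
        MeasurableSpace.comap (Sum.elim X τ j) inferInstance] (Sum.elim X τ j) := fun j hj =>
    measurable_iff_comap_le.2 (le_iSup₂_of_le j hj le_rfl)
  exact measurable_iff_comap_le.1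
    (Measurable.prodMk (hj (Sum.inl n) rfl) (hj (Sum.inr n) rfl))

end cavity

/-- The workload in a Cavity Queue has the law of the workload of any server under balanced
random. -/
theorem IsCavityWorkload.map_eq {Ω : Type*} [MeasurableSpace Ω] {Q : Measure Ω}
    [IsProbabilityMeasure Q] {V : ℕ → Ω → ℝ} (h : IsCavityWorkload Q p V) (i : Fin p.m) (n : ℕ) :
    Measurable (V n) ∧ Q.map (V n) = (brWorkloadLaw p n).map fun w => w i := by
  obtain ⟨X, τ, hX, hτ, hi, hlaw, hexp, h0, hs⟩ := h
  have hV := measurable_of_lindley hX hτ h0 hs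
  refine ⟨hV n, ?_⟩
  induction n with
  | zero =>
    rw [funext h0, Measure.map_const, measure_univ, one_smul, brWorkloadLaw,
      Measure.map_dirac' (measurable_pi_apply i)]
    rfl
  | succ n ih =>
    have hprod : Q.map (fun ω => (V n ω, X n ω, τ n ω)) =
        (Q.map (V n)).prod ((Q.map (X n)).prod (expMeasure (p.lam * p.m))) := by
      have h1 := (indepFun_iff_map_prod_eq_prod_map_map (hV n).aemeasurable
        ((hX n).prodMk (hτ n)).aemeasurable).1 (indepFun_lindley_past hX hτ hi h0 hs n)
      have h2 : IndepFun (X n) (τ n) Q := hi.indepFun (i := Sum.inl n) (j := Sum.inr n) (by simp)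
      rw [h1, (indepFun_iff_map_prod_eq_prod_map_map (hX n).aemeasurable
        (hτ n).aemeasurable).1 h2, hexp]
    have hu : Function.Injective fun l : ℕ => p.c * (l : ℝ) := fun l l' hl =>
      Nat.cast_injective (mul_left_cancel₀ p.c_pos.ne' hl)
    refine Measure.ext_of_lintegral _ fun f hf => ?_
    have hF : Measurable fun z : ℝ × ℝ × ℝ => f (max (z.1 + z.2.1 - p.μ * z.2.2) 0) :=
      hf.comp (by fun_prop)
    have hprobX : IsProbabilityMeasure (Q.map (X n)) :=
      Measure.isProbabilityMeasure_map (hX n).aemeasurable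
    have hG : Measurable fun v => ∑' l : ℕ, jobLaw p i l * drainMean p f v (p.c * l) :=
      Measurable.tsum fun l => ((measurable_drainMean hf).comp
        (measurable_id.prodMk measurable_const)).const_mul _
    have hev : Measurable fun w : Fin p.m → ℝ => w i := measurable_pi_apply i
    calc ∫⁻ x, f x ∂Q.map (V (n + 1))
        = ∫⁻ ω, f (max (V n ω + X n ω - p.μ * τ n ω) 0) ∂Q := by
          rw [lintegral_map hf (hV (n + 1))]
          simp_rw [hs n]
      _ = ∫⁻ z, f (max (z.1 + z.2.1 - p.μ * z.2.2) 0)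
            ∂(Q.map (V n)).prod ((Q.map (X n)).prod (expMeasure (p.lam * p.m))) := by
          rw [← hprod, lintegral_map hF ((hV n).prodMk ((hX n).prodMk (hτ n)))]
      _ = ∫⁻ v, ∑' l : ℕ, jobLaw p i l * drainMean p f v (p.c * l) ∂Q.map (V n) := by
          rw [lintegral_prod _ hF.aemeasurable]
          refine lintegral_congr fun v => ?_
          have hFv : Measurable fun z : ℝ × ℝ => f (max (v + z.1 - p.μ * z.2) 0) :=
            hF.comp measurable_prodMk_left
          rw [lintegral_prod _ hFv.aemeasurable]
          have hdv : Measurable fun x => drainMean p f v x :=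
            (measurable_drainMean hf).comp measurable_prodMk_left
          exact (lintegral_map hdv (hX n)).trans (lintegral_comp_of_atoms (hX n) (jobLaw p i) hu
            (fun l => by rw [hlaw n l, jobLaw_apply]) _)
      _ = ∫⁻ w, brStep p (fun x => f (x i)) w ∂brWorkloadLaw p n := by
          rw [ih, lintegral_map hG hev]
          simp_rw [brStep_comp_eval]
      _ = ∫⁻ x, f x ∂(brWorkloadLaw p (n + 1)).map fun w => w i := by
          rw [lintegral_map hf hev]
          exact (lintegral_brWorkloadLaw_succ n (hf.comp hev)).symm

end

/-! ### The delay of a request -/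

section

section delay

variable {m : ℕ}

theorem delay_nonneg {c : ℝ} (hc : 0 < c) {w : Fin m → ℝ} (hw : ∀ i, 0 ≤ w i) (r : Fin m → ℕ) :
    0 ≤ delay c w r := by
  by_cases hr : r = 0
  · rw [hr, delay_zero]
  · obtain ⟨i, hi⟩ := Function.ne_iff.1 hr
    have hi' : 0 < r i := Nat.pos_of_ne_zero hi
    exact le_trans (add_nonneg (hw i) (by positivity)) (le_delay hi')

/-- A lower set contains the delay if and only if it contains all the levels. -/
theorem delay_mem_iff {c : ℝ} {w : Fin m → ℝ} {r : Fin m → ℕ} (hr : r ≠ 0) {L : Set ℝ}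
    (hL : IsLowerSet L) :
    delay c w r ∈ L ↔ ∀ i ∈ Finset.univ.filter (fun i => 0 < r i), w i + c * (r i : ℝ) ∈ L := by
  constructor
  · intro h i hi
    exact hL (le_delay (by simpa using hi)) h
  · intro h
    have hne : (Finset.univ.filter fun i => 0 < r i).Nonempty := by
      obtain ⟨i, hi⟩ := Function.ne_iff.1 hr
      exact ⟨i, by simpa using Nat.pos_of_ne_zero hi⟩
    obtain ⟨i, hi, he⟩ := Finset.exists_mem_eq_sup' hne fun i => w i + c * (r i : ℝ)
    rw [delay, dif_pos hne, he]
    exact h i hi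

theorem measurable_delay (c : ℝ) (r : Fin m → ℕ) : Measurable fun w => delay c w r := by
  by_cases hne : (Finset.univ.filter fun i => 0 < r i).Nonempty
  · have : (fun w => delay c w r) = (Finset.univ.filter fun i => 0 < r i).sup' hne
        fun i (w : Fin m → ℝ) => w i + c * (r i : ℝ) := by
      funext w
      rw [delay, dif_pos hne, Finset.sup'_apply]
    rw [this]
    exact Finset.measurable_sup' hne fun i _ => (measurable_pi_apply i).add_const _
  · have : (fun w => delay c w r) = fun _ => 0 := by
      funext w
      rw [delay, dif_neg hne]
    rw [this]
    exact measurable_const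

theorem measurable_delay_pair (c : ℝ) :
    Measurable fun z : (Fin m → ℕ) × (Fin m → ℝ) => delay c z.2 z.1 :=
  measurable_from_prod_countable_right fun r => measurable_delay c r

theorem measurable_delay_comp {Ω : Type*} [MeasurableSpace Ω] (c : ℝ) {w : Ω → Fin m → ℝ}
    {s : Ω → Fin m → ℕ} (hw : Measurable w) (hs : Measurable s) :
    Measurable fun ω => delay c (w ω) (s ω) := by
  have h := (measurable_delay_pair c).comp (hs.prodMk hw)
  exact h

theorem delay_mono (c : ℝ) (r : Fin m → ℕ) : Monotone fun w => delay c w r := by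
  intro x y hxy
  by_cases hr : r = 0
  · simp only [hr, delay_zero, le_refl]
  · exact delay_le hr fun i hi => le_trans (by have := hxy i; linarith) (le_delay hi)

theorem delay_comp_le (c : ℝ) (w : Fin m → ℝ) (r : Fin m → ℕ) (σ : Equiv.Perm (Fin m)) :
    delay c (w ∘ σ) (r ∘ σ) ≤ delay c w r := by
  by_cases hr : r ∘ σ = 0
  · have : r = 0 := by
      funext i
      simpa using congrFun hr (σ.symm i)
    rw [this]
    exact (delay_zero c _).trans_le (delay_zero c w).ge
  · exact delay_le hr fun i hi => le_delay (w := w) (s := r) (i := σ i) hi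

theorem delay_comp (c : ℝ) (w : Fin m → ℝ) (r : Fin m → ℕ) (σ : Equiv.Perm (Fin m)) :
    delay c (w ∘ σ) (r ∘ σ) = delay c w r := by
  refine le_antisymm (delay_comp_le c w r σ) ?_
  have := delay_comp_le c (w ∘ σ) (r ∘ σ) σ.symm
  simpa only [Function.comp_assoc, Equiv.self_comp_symm, Function.comp_id] using this

theorem delay_convex (c : ℝ) (r : Fin m → ℕ) (x y : Fin m → ℝ) {a b : ℝ} (ha : 0 ≤ a)
    (hb : 0 ≤ b) (hab : a + b = 1) :
    delay c (a • x + b • y) r ≤ a * delay c x r + b * delay c y r := by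
  by_cases hr : r = 0
  · simp [hr, delay_zero]
  · refine delay_le hr fun i hi => ?_
    have h1 := mul_le_mul_of_nonneg_left (le_delay (c := c) (w := x) hi) ha
    have h2 := mul_le_mul_of_nonneg_left (le_delay (c := c) (w := y) hi) hb
    have : (a • x + b • y) i + c * (r i : ℝ) =
        a * (x i + c * (r i : ℝ)) + b * (y i + c * (r i : ℝ)) := by
      simp only [Pi.add_apply, Pi.smul_apply, smul_eq_mul]
      linear_combination (-(c * (r i : ℝ))) * hab
    linarith

/-- The mean cost of a typical balanced random request is a symmetric convex increasing function of
the workload, for every increasing convex cost of the delay. -/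
theorem symConvex_delay (c : ℝ) (α : ℕ → ℕ) (k : ℕ) {h : ℝ → ℝ} (hm : Monotone h)
    (hc : ConvexOn ℝ Set.univ h) :
    SymConvex fun w : Fin m → ℝ =>
      ∑' r, typicalBR m α k r * ENNReal.ofReal (h (delay c w r)) := by
  refine SymConvex.of_tsum (typicalBR_comp_apply α k · ·)
    (G := fun w r => ENNReal.ofReal (h (delay c w r))) ?_ ?_ ?_ ?_
  · exact fun r x y hxy => ENNReal.ofReal_le_ofReal (hm (delay_mono c r hxy))
  · exact fun σ w r => by rw [delay_comp]
  · intro r x y a b ha hb hab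
    rw [← ENNReal.ofReal_mul ha, ← ENNReal.ofReal_mul hb]
    refine (ENNReal.ofReal_le_ofReal ?_).trans ENNReal.ofReal_add_le
    exact (hm (delay_convex c r x y ha hb hab)).trans
      (hc.2 (Set.mem_univ _) (Set.mem_univ _) ha hb hab)
  · exact fun r => (hm.measurable.comp (measurable_delay c r)).ennreal_ofReal

end delay

theorem prob_lt_eq_one_sub {Ω : Type*} [MeasurableSpace Ω] (R : Measure Ω) [IsProbabilityMeasure R]
    {u : Ω → ℝ} (hu : Measurable u) (t : ℝ) : R {x | t < u x} = 1 - R {x | u x ≤ t} := by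
  rw [← prob_compl_eq_one_sub (measurableSet_le hu measurable_const)]
  congr 1
  ext x
  simp

/-- Association makes the maximum stochastically smaller than for independent coordinates with the
same marginals. -/
theorem PosAssoc.lintegral_delay_le {m : ℕ} {ν : Measure (Fin m → ℝ)} [IsProbabilityMeasure ν]
    (hν : PosAssoc ν) {Ω : Type*} [MeasurableSpace Ω] {Q : Measure Ω} [IsProbabilityMeasure Q]
    {Y : Fin m → Ω → ℝ} (hY : ∀ i, Measurable (Y i)) (hi : iIndepFun Y Q)
    (hlaw : ∀ i, Q.map (Y i) = ν.map fun w => w i) (c : ℝ) (r : Fin m → ℕ) {h : ℝ → ℝ}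
    (hm : Monotone h) :
    ∫⁻ w, ENNReal.ofReal (h (delay c w r)) ∂ν ≤
      ∫⁻ ω, ENNReal.ofReal (h (delay c (fun i => Y i ω) r)) ∂Q := by
  by_cases hr : r = 0
  · simp [hr, delay_zero]
  set H : ℝ → ℝ := fun y => max (h y) 0 with hH
  have hHm : Monotone H := fun x y hxy => max_le_max (hm hxy) le_rfl
  have hof : ∀ y, ENNReal.ofReal (h y) = ENNReal.ofReal (H y) := fun y => by simp [hH]
  have hdm : Measurable fun w : Fin m → ℝ => H (delay c w r) :=
    hHm.measurable.comp (measurable_delay c r)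
  have hYm : Measurable fun ω i => Y i ω := measurable_pi_lambda _ hY
  have hdY : Measurable fun ω => H (delay c (fun i => Y i ω) r) := hdm.comp hYm
  simp_rw [hof]
  have hH0 : ∀ y, 0 ≤ H y := fun y => le_max_right _ _
  rw [lintegral_eq_lintegral_meas_lt ν (ae_of_all _ fun w => hH0 _) hdm.aemeasurable,
    lintegral_eq_lintegral_meas_lt Q (ae_of_all _ fun ω => hH0 _) hdY.aemeasurable]
  refine lintegral_mono fun t => ?_
  -- the levels at which the cost is at most `t`
  set L : Fin m → Set ℝ := fun i => {y | H (y + c * (r i : ℝ)) ≤ t}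
  have hL : ∀ i, IsLowerSet (L i) := fun i x y hxy hx =>
    (hHm (by linarith : y + c * (r i : ℝ) ≤ x + c * (r i : ℝ))).trans hx
  have hLm : ∀ i, MeasurableSet (L i) := fun i =>
    measurableSet_le (hHm.measurable.comp (measurable_id.add_const _)) measurable_const
  have hiff : ∀ w : Fin m → ℝ, H (delay c w r) ≤ t ↔
      ∀ i ∈ Finset.univ.filter (fun i => 0 < r i), w i ∈ L i := fun w =>
    delay_mem_iff (L := {y | H y ≤ t}) hr fun x y hxy hx => (hHm hxy).trans hx
  have hle : Q {ω | H (delay c (fun i => Y i ω) r) ≤ t} ≤ ν {w | H (delay c w r) ≤ t} := by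
    have e1 : Q {ω | H (delay c (fun i => Y i ω) r) ≤ t} =
        ∏ i ∈ Finset.univ.filter (fun i => 0 < r i), ν {w | w i ∈ L i} := by
      have e2 : {ω | H (delay c (fun i => Y i ω) r) ≤ t} =
          ⋂ i ∈ Finset.univ.filter (fun i => 0 < r i), Y i ⁻¹' L i := by
        ext ω
        simp only [Set.mem_ofPred_eq, hiff, Set.mem_iInter, Set.mem_preimage]
      rw [e2, hi.measure_inter_preimage_eq_mul _ fun i _ => hLm i]
      refine Finset.prod_congr rfl fun i _ => ?_
      rw [← Measure.map_apply (hY i) (hLm i), hlaw i,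
        Measure.map_apply (measurable_pi_apply i) (hLm i)]
      rfl
    rw [e1]
    simp_rw [hiff]
    exact hν.prod_le_forall _ hL hLm
  rw [prob_lt_eq_one_sub ν hdm, prob_lt_eq_one_sub Q hdY]
  exact tsub_le_tsub_left hle 1

/-! ### The law of the file sizes -/

theorem IsSystem.measure_size_eq {Ω : Type*} [MeasurableSpace Ω] {P : Measure Ω} {p : Params}
    {pol : Policy} {κ : ℕ → Ω → ℕ} {a s : ℕ → Ω → Fin p.m → ℕ} {τ : ℕ → Ω → ℝ}
    {W : ℕ → Ω → Fin p.m → ℝ} [IsProbabilityMeasure P] (h : IsSystem P p pol κ a s τ W)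
    (n k : ℕ) : P {ω | κ n ω = k} = p.π k := by
  have h1 := h.lintegral_step n (F := fun k' _ _ _ => if k' = k then 1 else 0)
    fun _ _ => measurable_const
  have e1 : ∫⁻ ω, (if κ n ω = k then 1 else 0 : ℝ≥0∞) ∂P = P {ω | κ n ω = k} := by
    have hset : MeasurableSet {ω | κ n ω = k} := h.measurable_κ n (measurableSet_singleton k)
    rw [← lintegral_indicator_one hset]
    refine lintegral_congr fun ω => ?_
    simp [Set.indicator_apply]
  rw [e1] at h1
  rw [h1]
  simp_rw [lintegral_const, measure_univ, mul_one, ENNReal.tsum_mul_right, ENNReal.tsum_mul_left,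
    PMF.tsum_coe, mul_one, ENNReal.tsum_mul_left, PMF.tsum_coe, mul_one]
  rw [tsum_eq_single k (by intro b hb; simp [hb])]
  simp

/-! ### The increasing convex order -/

/-- The identity `z⁺ + y⁻ = (z - y) + z⁻ + y⁺` for `y ≤ z`. -/
theorem ofReal_add_ofReal_neg {z y : ℝ} (h : y ≤ z) :
    ENNReal.ofReal z + ENNReal.ofReal (-y) =
      ENNReal.ofReal (z - y) + ENNReal.ofReal (-z) + ENNReal.ofReal y := by
  rcases le_total 0 y with hy | hy
  · rw [ENNReal.ofReal_of_nonpos (by linarith : -y ≤ 0),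
      ENNReal.ofReal_of_nonpos (by linarith : -z ≤ 0), add_zero, add_zero,
      ← ENNReal.ofReal_add (by linarith) hy, sub_add_cancel]
  · rw [ENNReal.ofReal_of_nonpos hy, add_zero]
    rcases le_total 0 z with hz | hz
    · rw [ENNReal.ofReal_of_nonpos (by linarith : -z ≤ 0), add_zero,
        ← ENNReal.ofReal_add hz (by linarith), sub_eq_add_neg]
    · rw [ENNReal.ofReal_of_nonpos hz, zero_add, ← ENNReal.ofReal_add (by linarith) (by linarith)]
      congr 1
      ring

/-- The expectation of a random variable that is bounded below. -/
theorem extExpectation_eq {Ω : Type*} [MeasurableSpace Ω] {P : Measure Ω} [IsProbabilityMeasure P]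
    {Z : Ω → ℝ} (hZ : Measurable Z) {y : ℝ} (hy : ∀ ω, y ≤ Z ω) :
    extExpectation P Z = ((∫⁻ ω, ENNReal.ofReal (Z ω - y) ∂P : ℝ≥0∞) : EReal) + (y : EReal) := by
  have h1 : ∫⁻ ω, ENNReal.ofReal (Z ω) ∂P + ENNReal.ofReal (-y) =
      ∫⁻ ω, ENNReal.ofReal (Z ω - y) ∂P + ∫⁻ ω, ENNReal.ofReal (-Z ω) ∂P +
        ENNReal.ofReal y := by
    have hneg : Measurable fun ω => ENNReal.ofReal (-Z ω) := hZ.neg.ennreal_ofReal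
    have := lintegral_congr (μ := P) fun ω => ofReal_add_ofReal_neg (hy ω)
    rwa [lintegral_add_right _ measurable_const, lintegral_add_right _ measurable_const,
      lintegral_add_right _ hneg, lintegral_const, lintegral_const, measure_univ,
      mul_one, mul_one] at this
  have h2 : ∫⁻ ω, ENNReal.ofReal (-Z ω) ∂P ≠ ∞ := by
    refine ne_top_of_le_ne_top (b := ENNReal.ofReal (-y)) ENNReal.ofReal_ne_top ?_
    refine (lintegral_mono (g := fun _ => ENNReal.ofReal (-y)) fun ω =>
      ENNReal.ofReal_le_ofReal (neg_le_neg (hy ω))).trans ?_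
    simp
  rw [extExpectation]
  generalize ∫⁻ ω, ENNReal.ofReal (Z ω) ∂P = A at h1
  generalize ∫⁻ ω, ENNReal.ofReal (-Z ω) ∂P = B at h1 h2
  generalize ∫⁻ ω, ENNReal.ofReal (Z ω - y) ∂P = D at h1
  lift B to NNReal using h2
  by_cases hD : D = ∞
  · have hA : A = ∞ := by
      by_contra hA
      rw [hD] at h1
      simp only [top_add] at h1
      exact (ENNReal.add_ne_top.2 ⟨hA, ENNReal.ofReal_ne_top⟩) h1
    rw [hA, hD]
    simp only [EReal.coe_ennreal_top, EReal.top_add_coe]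
    exact EReal.top_sub_coe (B : ℝ)
  · have hA : A ≠ ∞ := by
      intro hA
      rw [hA] at h1
      simp only [top_add] at h1
      exact (ENNReal.add_ne_top.2 ⟨ENNReal.add_ne_top.2 ⟨hD, ENNReal.coe_ne_top⟩,
        ENNReal.ofReal_ne_top⟩) h1.symm
    lift A to NNReal using hA
    lift D to NNReal using hD
    have h3 := congrArg ENNReal.toReal h1
    rw [ENNReal.toReal_add (by simp) (by simp), ENNReal.toReal_add (by simp) (by simp),
      ENNReal.toReal_add (by simp) (by simp), ENNReal.toReal_ofReal', ENNReal.toReal_ofReal'] at h3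
    simp only [ENNReal.coe_toReal] at h3
    have h4 : (A : ℝ) - B = D + y := by
      rcases le_total 0 y with hy0 | hy0
      · rw [max_eq_right (by linarith), max_eq_left hy0] at h3; linarith
      · rw [max_eq_left (by linarith), max_eq_right hy0] at h3; linarith
    have h5 := congrArg (fun x : ℝ => (x : EReal)) h4
    simp only [EReal.coe_sub, EReal.coe_add] at h5
    exact h5

/-- For nonnegative variables an increasing convex `g` satisfies `g 0 ≤ g X`, so the comparison of
extended expectations reduces to that of the means of the nonnegative variables `g X - g 0`. -/
theorem icxLE_of_lintegral_le {Ω Ω' : Type*} [MeasurableSpace Ω] [MeasurableSpace Ω']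
    {P : Measure Ω} {Q : Measure Ω'} [IsProbabilityMeasure P] [IsProbabilityMeasure Q]
    {X : Ω → ℝ} {Y : Ω' → ℝ} (hX : Measurable X) (hY : Measurable Y) (hX0 : ∀ ω, 0 ≤ X ω)
    (hY0 : ∀ ω, 0 ≤ Y ω)
    (h : ∀ g : ℝ → ℝ, Monotone g → ConvexOn ℝ Set.univ g →
      ∫⁻ ω, ENNReal.ofReal (g (X ω)) ∂P ≤ ∫⁻ ω, ENNReal.ofReal (g (Y ω)) ∂Q) :
    IcxLE P X Q Y := by
  intro g hm hc _ _
  have hgX : Measurable fun ω => g (X ω) := hm.measurable.comp hX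
  have hgY : Measurable fun ω => g (Y ω) := hm.measurable.comp hY
  rw [extExpectation_eq hgX fun ω => hm (hX0 ω), extExpectation_eq hgY fun ω => hm (hY0 ω)]
  refine add_le_add_left (EReal.coe_ennreal_le_coe_ennreal_iff.2 ?_) _
  exact h (fun x => g x + -g 0) (fun x y hxy => add_le_add_left (hm hxy) _)
    (hc.add (convexOn_const (-g 0) convex_univ))

/-! ### Comparison of the delays -/

section comparison

variable {Ω : Type*} [MeasurableSpace Ω] {P : Measure Ω} {p : Params} {pol : Policy}
  {κ : ℕ → Ω → ℕ} {a s : ℕ → Ω → Fin p.m → ℕ} {τ : ℕ → Ω → ℝ} {W : ℕ → Ω → Fin p.m → ℝ}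

theorem IsSystem.W_nonneg (h : IsSystem P p pol κ a s τ W) (n : ℕ) (ω : Ω) (i : Fin p.m) :
    0 ≤ W n ω i := by
  cases n with
  | zero => rw [h.W_zero]; rfl
  | succ n => rw [h.W_succ]; exact le_max_right _ _

/-- The delay of a request for `k` chunks under any policy is dominated by the delay of a typical
balanced random request that sees the balanced random workload. -/
theorem IsSystem.lintegral_delay_cond_le [IsProbabilityMeasure P]
    (hS : IsSystem P p pol κ a s τ W) (n : ℕ) {k : ℕ} (hk : p.π k ≠ 0) {h : ℝ → ℝ}
    (hm : Monotone h) (hc : ConvexOn ℝ Set.univ h) :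
    ∫⁻ ω, ENNReal.ofReal (h (delay p.c (W n ω) (s n ω))) ∂P[|{ω | κ n ω = k}] ≤
      ∑' r, typicalBR p.m p.α k r *
        ∫⁻ w, ENNReal.ofReal (h (delay p.c w r)) ∂brWorkloadLaw p n := by
  have hmeas : ∀ r, Measurable fun w : Fin p.m → ℝ => ENNReal.ofReal (h (delay p.c w r)) :=
    fun r => (hm.measurable.comp (measurable_delay p.c r)).ennreal_ofReal
  have hset : MeasurableSet {ω | κ n ω = k} := hS.measurable_κ n (measurableSet_singleton k)
  have h1 : ∫⁻ ω in {ω | κ n ω = k}, ENNReal.ofReal (h (delay p.c (W n ω) (s n ω))) ∂P ≤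
      p.π k * ∫⁻ w, ∑' r, typicalBR p.m p.α k r * ENNReal.ofReal (h (delay p.c w r))
        ∂brWorkloadLaw p n := by
    have hsym := symConvex_delay (m := p.m) p.c p.α k hm hc
    refine le_trans ?_ (mul_le_mul_right (hS.lintegral_W_le n hsym) (p.π k))
    have hsymW : Measurable fun ω => ∑' r, typicalBR p.m p.α k r *
        ENNReal.ofReal (h (delay p.c (W n ω) r)) := hsym.measurable.comp (hS.measurable_W n)
    rw [← lintegral_const_mul _ hsymW, ← lintegral_indicator hset]
    have h2 := hS.lintegral_step_le n
      (F := fun k' w r _ => if k' = k then ENNReal.ofReal (h (delay p.c w r)) else 0) ?_ ?_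
    · refine le_trans (le_of_eq (lintegral_congr fun ω => ?_)) (h2.trans (le_of_eq
        (lintegral_congr fun ω => ?_)))
      · simp [Set.indicator_apply]
      · rw [tsum_eq_single k (by intro b hb; simp [hb])]
        simp
    · intro k' r
      by_cases hk' : k' = k
      · simp only [hk', if_true]
        exact (hmeas r).comp measurable_fst
      · simp [hk']
    · intro k' w s r t hG hs
      split
      · exact ENNReal.ofReal_le_ofReal (hm (hG.delay_le p.c_pos hs))
      · exact le_rfl
  rw [lintegral_tsum fun r => ((hmeas r).const_mul _).aemeasurable] at h1
  simp_rw [lintegral_const_mul _ (hmeas _)] at h1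
  rw [ProbabilityTheory.cond, lintegral_smul_measure, hS.measure_size_eq, smul_eq_mul]
  refine (mul_le_mul_right h1 _).trans_eq ?_
  rw [← mul_assoc, ENNReal.inv_mul_cancel hk (PMF.apply_ne_top _ _), one_mul]

end comparison

end

end DataCluster


open DataCluster in
theorem mainTheorem4 (p : Params) (hπ : p.π ∈ Theta p.m p.α) :
    (∀ (Ω : Type*) [MeasurableSpace Ω] (P : Measure Ω) [IsProbabilityMeasure P]
        (κ : ℕ → Ω → ℕ) (a s : ℕ → Ω → Fin p.m → ℕ) (τ : ℕ → Ω → ℝ)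
        (W : ℕ → Ω → Fin p.m → ℝ),
      IsSystem P p Policy.BR κ a s τ W → ∀ n, Associated P (W n)) ∧
    (∀ (pol : Policy) (Ω : Type*) [MeasurableSpace Ω] (P : Measure Ω) [IsProbabilityMeasure P]
        (κ : ℕ → Ω → ℕ) (a s : ℕ → Ω → Fin p.m → ℕ) (τ : ℕ → Ω → ℝ)
        (W : ℕ → Ω → Fin p.m → ℝ),
      IsSystem P p pol κ a s τ W →
      ∀ (k : ℕ), p.π k ≠ 0 →
      ∀ (Ω' : Type*) [MeasurableSpace Ω'] (Q : Measure Ω') [IsProbabilityMeasure Q]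
        (V : Fin p.m → ℕ → Ω' → ℝ) (S : Ω' → Fin p.m → ℕ),
      (∀ i, IsCavityWorkload Q p (V i)) →
      iIndepFun (fun i ω n => V i n ω) Q →
      Measurable S → Q.map S = (typicalBR p.m p.α k).toMeasure →
      IndepFun S (fun ω i n => V i n ω) Q →
      ∀ n, IcxLE (P[|{ω | κ n ω = k}]) (fun ω => delay p.c (W n ω) (s n ω))
        Q (fun ω => delay p.c (fun i => V i n ω) (S ω))) := by
  refine ⟨?_, ?_⟩
  · intro Ω _ P _ κ a s τ W h n
    refine PosAssoc.associated (h.measurable_W n) ?_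
    rw [h.map_W_eq n]
    exact posAssoc_brWorkloadLaw hπ n
  · intro pol Ω _ P _ κ a s τ W hS k hk Ω' _ Q _ V S hV hVi hSm hSlaw hSV n
    have hVm : ∀ i, Measurable (V i n) := fun i => ((hV i).map_eq i n).1
    have hVnm : Measurable fun ω i => V i n ω := measurable_pi_lambda _ hVm
    have hVn0 : ∀ i ω, 0 ≤ V i n ω := by
      intro i ω
      obtain ⟨X, τ', -, -, -, -, -, h0, hs⟩ := hV i
      cases n with
      | zero => rw [h0]
      | succ n => rw [hs]; exact le_max_right _ _
    have hcond : IsProbabilityMeasure (P[|{ω | κ n ω = k}]) :=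
      cond_isProbabilityMeasure (by rwa [hS.measure_size_eq])
    have hX : Measurable fun ω => delay p.c (W n ω) (s n ω) :=
      measurable_delay_comp p.c (hS.measurable_W n) (hS.measurable_s n)
    have hY : Measurable fun ω => delay p.c (fun i => V i n ω) (S ω) :=
      measurable_delay_comp p.c hVnm hSm
    refine icxLE_of_lintegral_le hX hY
      (fun ω => delay_nonneg p.c_pos (hS.W_nonneg n ω) _)
      (fun ω => delay_nonneg p.c_pos (fun i => hVn0 i ω) _) fun h hm hc => ?_
    refine (hS.lintegral_delay_cond_le n hk hm hc).trans ?_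
    have hVi' : iIndepFun (fun i => V i n) Q :=
      hVi.comp (fun _ (u : ℕ → ℝ) => u n) fun _ => measurable_pi_apply n
    have hSV' : IndepFun S (fun ω i => V i n ω) Q :=
      hSV.comp (φ := id) (ψ := fun (u : Fin p.m → ℕ → ℝ) i => u i n) measurable_id
        (measurable_pi_lambda _ fun i => (measurable_pi_apply n).comp (measurable_pi_apply i))
    have hpair := (indepFun_iff_map_prod_eq_prod_map_map hSm.aemeasurable hVnm.aemeasurable).1 hSV'
    have hcost : Measurable fun z : (Fin p.m → ℕ) × (Fin p.m → ℝ) =>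
        ENNReal.ofReal (h (delay p.c z.2 z.1)) :=
      (hm.measurable.comp (measurable_delay_pair p.c)).ennreal_ofReal
    have hVprob : IsProbabilityMeasure (Q.map fun ω i => V i n ω) :=
      Measure.isProbabilityMeasure_map hVnm.aemeasurable
    rw [← lintegral_map (f := fun z : (Fin p.m → ℕ) × (Fin p.m → ℝ) =>
        ENNReal.ofReal (h (delay p.c z.2 z.1))) hcost (hSm.prodMk hVnm), hpair, hSlaw,
      lintegral_prod _ hcost.aemeasurable, lintegral_toMeasure]
    refine ENNReal.tsum_le_tsum fun r => mul_le_mul_right ?_ _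
    have hr : Measurable fun w : Fin p.m → ℝ => ENNReal.ofReal (h (delay p.c w r)) :=
      (hm.measurable.comp (measurable_delay p.c r)).ennreal_ofReal
    rw [lintegral_map hr hVnm]
    exact (posAssoc_brWorkloadLaw hπ n).lintegral_delay_le hVm hVi'
      (fun i => ((hV i).map_eq i n).2) p.c r hm
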